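/- Let $\mathbb{F}$ be a field. For an $n\times m$ matrix $A$ over $\mathbb{F}$ and a real number $r\ge 0$, let the rigidity $R_{\mathbb{F}}(A,r)$ be the least number of non-zero entries of a matrix $Z\in\mathbb{F}^{n\times m}$ with $\operatorname{rank}(A-Z)\le r$; for a square matrix $A\in\mathbb{F}^{n\times n}$, let the row-column rigidity $R^{rc}_{\mathbb{F}}(A,r)$ be the least $t$ for which there is $Z\in\mathbb{F}^{n\times n}$ such that $\operatorname{rank}(A-Z)\le r$ and every row and every column of $Z$ has at most $t$ non-zero entries. All logarithms below are to one and the same arbitrary fixed base $\beta>1$. A sequence of square matrices over $\mathbb{F}$ of strictly increasing orders is called Valiant-rigid if there is an $\varepsilon>0$ such that $R_{\mathbb{F}}(A,\,n/\log\log n)\ge n^{1+\varepsilon}$ for all members $A$ of the sequence of sufficiently large order $n$. A family of square matrices over $\mathbb{F}$ is called not Valiant-rigid over $\mathbb{F}$ if no infinite sequence of matrices of the family with strictly increasing orders is Valiant-rigid. Let $\mathcal{F}$ be a family of square matrices over $\mathbb{F}$. Suppose that for every $0<\varepsilon<1/2$ there exists an integer $b\ge 2$ such that every $d\times d$ matrix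 $A\in\mathcal{F}$ satisfies either $d\le b$ or $$R^{rc}_{\mathbb{F}}\left(A,\,d^{1-\gamma}\right)\le d^{\varepsilon},\qquad\text{where}\quad \gamma=\frac{12(\log\log d)^2}{\varepsilon^3\log d}.$$ Then the family of all Kronecker products $M_1\otimes M_2\otimes\cdots\otimes M_k$ with $k\ge 1$ and $M_1,\dots,M_k\in\mathcal{F}$ is not Valiant-rigid over $\mathbb{F}$. -/

import Mathlib

/-- Square matrices over `𝔽` of arbitrary order: `A.1` is the order, `A.2` the matrix. -/
abbrev SqMat (𝔽 : Type*) : Type _ := Σ n : ℕ, Matrix (Fin n) (Fin n) 𝔽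

/-- The rigidity `R_𝔽(A, r)`: the least number of non-zero entries of a matrix `Z` over `𝔽`
such that `A - Z` has rank at most `r`. (The set of such numbers is never empty: take `Z = A`.) -/
noncomputable def rigidity {𝔽 : Type*} [Field 𝔽] {n m : ℕ} (A : Matrix (Fin n) (Fin m) 𝔽)
    (r : ℕ) : ℕ :=
  sInf {t : ℕ | ∃ Z : Matrix (Fin n) (Fin m) 𝔽, (A - Z).rank ≤ r ∧
    {p : Fin n × Fin m | Z p.1 p.2 ≠ 0}.ncard = t}

/-- The row-column rigidity `R^{rc}_𝔽(A, r)`: the least `t` for which there is a matrix `Z` over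
`𝔽` such that `A - Z` has rank at most `r` and every row and every column of `Z` has at most `t`
non-zero entries. -/
noncomputable def rcRigidity {𝔽 : Type*} [Field 𝔽] {n : ℕ} (A : Matrix (Fin n) (Fin n) 𝔽)
    (r : ℕ) : ℕ :=
  sInf {t : ℕ | ∃ Z : Matrix (Fin n) (Fin n) 𝔽, (A - Z).rank ≤ r ∧
    (∀ i, {j | Z i j ≠ 0}.ncard ≤ t) ∧ (∀ j, {i | Z i j ≠ 0}.ncard ≤ t)}

/-- The Kronecker product of an `n × n` and an `m × m` matrix as an `nm × nm` matrix, with the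
usual (block) ordering of rows and columns. -/
def SqMat.kron {𝔽 : Type*} [Field 𝔽] (A B : SqMat 𝔽) : SqMat 𝔽 :=
  ⟨A.1 * B.1, Matrix.reindex finProdFinEquiv finProdFinEquiv
    (Matrix.kroneckerMap (fun x y => x * y) A.2 B.2)⟩

/-- `IsKroneckerProduct F M`: for some `k ≥ 1` and some `M₁, …, M_k ∈ F` (repetitions allowed),
`M` is `M₁ ⊗ (M₂ ⊗ (⋯ ⊗ M_k))`. -/
inductive IsKroneckerProduct {𝔽 : Type*} [Field 𝔽] (F : Set (SqMat 𝔽)) : SqMat 𝔽 → Prop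
  | single {A : SqMat 𝔽} (hA : A ∈ F) : IsKroneckerProduct F A
  | kron {A B : SqMat 𝔽} (hA : A ∈ F) (hB : IsKroneckerProduct F B) :
      IsKroneckerProduct F (A.kron B)

/-- The family of Kronecker products of matrices from `F`. -/
def kroneckerProducts {𝔽 : Type*} [Field 𝔽] (F : Set (SqMat 𝔽)) : Set (SqMat 𝔽) :=
  {M | IsKroneckerProduct F M}

/-- A sequence of square matrices is Valiant-rigid (logarithms to base `β`) if, for some `ε > 0`,
`R_𝔽(A, n / log log n) ≥ n ^ (1 + ε)` for every member `A` of sufficiently large order `n`. -/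
def ValiantRigidSeq {𝔽 : Type*} [Field 𝔽] (β : ℝ) (A : ℕ → SqMat 𝔽) : Prop :=
  ∃ ε : ℝ, 0 < ε ∧ ∃ N : ℕ, ∀ i : ℕ, N ≤ (A i).1 →
    ((A i).1 : ℝ) ^ (1 + ε) ≤
      (rigidity (A i).2 ⌊((A i).1 : ℝ) / Real.logb β (Real.logb β (A i).1)⌋₊ : ℝ)

/-- A family of square matrices is not Valiant-rigid if no sequence of its members of strictly
increasing order is Valiant-rigid. -/
def NotValiantRigid {𝔽 : Type*} [Field 𝔽] (β : ℝ) (F : Set (SqMat 𝔽)) : Prop :=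
  ∀ A : ℕ → SqMat 𝔽, (∀ i, A i ∈ F) → StrictMono (fun i => (A i).1) → ¬ ValiantRigidSeq β A

/-- `γ = 12 (log log d)² / (ε³ log d)`, logarithms to base `β`. -/
noncomputable def gammaExp (β ε : ℝ) (d : ℕ) : ℝ :=
  12 * (Real.logb β (Real.logb β d)) ^ 2 / (ε ^ 3 * Real.logb β d)

/-- Every `d × d` member `A` of the family has `d ≤ b` or satisfies
`R^{rc}_𝔽(A, d ^ (1 - γ)) ≤ d ^ ε` for `γ = 12 (log log d)² / (ε³ log d)`. -/
def BoundedOrNonRigid {𝔽 : Type*} [Field 𝔽] (β ε : ℝ) (b : ℕ) (F : Set (SqMat 𝔽)) : Prop :=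
  ∀ A ∈ F, A.1 ≤ b ∨
    (rcRigidity A.2 ⌊(A.1 : ℝ) ^ (1 - gammaExp β ε A.1)⌋₊ : ℝ) ≤ (A.1 : ℝ) ^ ε

open scoped Kronecker

/-! Measure rank relative to the order, writing ρ for the relative rank and τ for the row sparsity.
Under matrix products and Kronecker products the ρ's add and the τ's multiply, so a long product can
be treated in groups of factors.

Let n be the order of the product and L = log n. Sort the factors by order d: bounded ones, and
dyadic classes 2^j ≤ log d < 2^(j+1). This gives m = O(log L) classes. A class of total order at
most n^(ε/m) is kept as sparse part; all of these together cost at most n^ε. Every other class of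
order N must reach sparsity N^(4ε) with ρ ≤ 1/(m log L). Summing over classes gives ρ ≤ 1/log log n
and τ ≤ n^(5ε), which contradicts Valiant-rigidity once ε is small.

Bounded factors (`NonRigid.exists_of_bounded`): each is a product of boundedly many diagonal
matrices and unit transvections, so Kronecker products of k transvections suffice. Factor a
transvection as F * G so that along every nonzero path x → w → y a deviation of y from the swapped
index is paid for by a mean-zero weight. By concentration, deleting an exponentially small fraction
of indices leaves rows with few entries (`NonRigid.piKronecker_unitTransvection`).

Dyadic classes (`NonRigid.kronList_dyadic`): write each factor as sparse plus low rank and expand.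
Terms with at least εk low-rank factors have tiny rank, and the others are sparse
(`NonRigid.kronList_threshold`). Since d^(-γ) ≤ exp(-c j²), the relative rank is exp(-Ω(k j²)). A
class that is not small has either many factors or j of order log L, and then j² beats log(m log L).
Only c > 0 matters here. -/

/-- `M` becomes a matrix of rank at most `ρ` times its order after changing at most `τ` entries in
each row. -/
def NonRigid {𝔽 X : Type*} [Field 𝔽] [Fintype X] (M : Matrix X X 𝔽) (ρ τ : ℝ) : Prop :=
  ∃ Z : Matrix X X 𝔽, ((M - Z).rank : ℝ) ≤ ρ * Fintype.card X ∧
    ∀ i, ({j | Z i j ≠ 0}.ncard : ℝ) ≤ τ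

/-! ### Rank inequalities for sums and Kronecker products. -/

section Rank

variable {𝔽 X Y : Type*} [Field 𝔽] [Fintype X] [Fintype Y]

theorem Matrix.exists_mul_eq_of_rank {X : Type*} (A : Matrix X Y 𝔽) :
    ∃ (P : Matrix X (Fin A.rank) 𝔽) (Q : Matrix (Fin A.rank) Y 𝔽), P * Q = A := by
  classical
  let b := Module.finBasisOfFinrankEq 𝔽 (LinearMap.range A.mulVecLin) (n := A.rank) rfl
  let v : Y → LinearMap.range A.mulVecLin := fun c => ⟨A.mulVecLin (Pi.single c 1), ⟨_, rfl⟩⟩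
  refine ⟨Matrix.of fun i j => (b j : X → 𝔽) i, Matrix.of fun j c => b.repr (v c) j, ?_⟩
  ext i c
  have h := congrArg (fun w : LinearMap.range A.mulVecLin => (w : X → 𝔽) i) (b.sum_repr (v c))
  have h' : ((v c : LinearMap.range A.mulVecLin) : X → 𝔽) i = A i c := by simp [v]
  rw [← h']
  refine Eq.trans ?_ h
  simp only [Matrix.mul_apply, Matrix.of_apply, Submodule.coe_sum, Finset.sum_apply,
    Submodule.coe_smul, Pi.smul_apply, smul_eq_mul, mul_comm]

theorem Matrix.rank_add_le_add {X : Type*} (A B : Matrix X Y 𝔽) : (A + B).rank ≤ A.rank + B.rank := by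
  rw [Matrix.rank, Matrix.mulVecLin_add]
  refine (Submodule.finrank_mono (LinearMap.range_add_le _ _)).trans ?_
  exact Submodule.finrank_add_le_finrank_add_finrank _ _

theorem Matrix.rank_kronecker_le (A : Matrix X X 𝔽) (B : Matrix Y Y 𝔽) :
    (A ⊗ₖ B).rank ≤ A.rank * B.rank := by
  obtain ⟨P, Q, h⟩ := A.exists_mul_eq_of_rank
  obtain ⟨P', Q', h'⟩ := B.exists_mul_eq_of_rank
  have : A ⊗ₖ B = (P ⊗ₖ P') * (Q ⊗ₖ Q') := by
    rw [← Matrix.mul_kronecker_mul, h, h']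
  rw [this]
  refine (Matrix.rank_mul_le_left _ _).trans ((Matrix.rank_le_card_width _).trans ?_)
  simp

end Rank

/-! ### Calculus of non-rigidity under products and Kronecker products. -/

namespace NonRigid

variable {𝔽 X Y : Type*} [Field 𝔽] [Fintype X] [Fintype Y]

theorem mono {M : Matrix X X 𝔽} {ρ τ ρ' τ' : ℝ} (h : NonRigid M ρ τ) (hρ : ρ ≤ ρ')
    (hτ : τ ≤ τ') : NonRigid M ρ' τ' := by
  obtain ⟨Z, h1, h2⟩ := h
  exact ⟨Z, h1.trans (by gcongr), fun i => (h2 i).trans hτ⟩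

theorem self (M : Matrix X X 𝔽) : NonRigid M 0 (Fintype.card X) := by
  refine ⟨M, by simp, fun i => ?_⟩
  rw [← Nat.card_eq_fintype_card, Nat.cast_le]
  exact Set.ncard_le_card _

theorem trivial (M : Matrix X X 𝔽) {τ : ℝ} (hτ : 0 ≤ τ) : NonRigid M 1 τ := by
  refine ⟨0, ?_, fun i => by simpa using hτ⟩
  rw [one_mul, Nat.cast_le]
  exact Matrix.rank_le_card_width _

theorem tau_nonneg [Nonempty X] {M : Matrix X X 𝔽} {ρ τ : ℝ} (h : NonRigid M ρ τ) : 0 ≤ τ := by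
  obtain ⟨Z, -, h2⟩ := h
  exact (Nat.cast_nonneg _).trans (h2 (Classical.arbitrary X))

theorem of_equiv {M : Matrix X X 𝔽} {N : Matrix Y Y 𝔽} {ρ τ : ℝ} (e : X ≃ Y)
    (he : ∀ i j, M i j = N (e i) (e j)) (h : NonRigid N ρ τ) : NonRigid M ρ τ := by
  obtain ⟨Z, h1, h2⟩ := h
  refine ⟨Z.submatrix e e, ?_, fun i => ?_⟩
  · have : M - Z.submatrix e e = (N - Z).submatrix e e := by ext; simp [he]
    rw [this, Matrix.rank_submatrix, Fintype.card_congr e]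
    exact h1
  · refine le_trans (le_of_eq ?_) (h2 (e i))
    congr 1
    exact Set.ncard_congr' (e.subtypeEquiv fun _ => by simp)

theorem mul {A B : Matrix X X 𝔽} {ρ₁ τ₁ ρ₂ τ₂ : ℝ} (hA : NonRigid A ρ₁ τ₁)
    (hB : NonRigid B ρ₂ τ₂) : NonRigid (A * B) (ρ₁ + ρ₂) (τ₁ * τ₂) := by
  classical
  rcases isEmpty_or_nonempty X with hX | hX
  · refine ⟨0, ?_, fun i => isEmptyElim i⟩
    rw [Fintype.card_eq_zero, Nat.cast_zero, mul_zero]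
    exact_mod_cast (Matrix.rank_le_card_width _).trans_eq Fintype.card_eq_zero
  have hτ₂ := hB.tau_nonneg
  obtain ⟨Z, h1, h2⟩ := hA
  obtain ⟨W, h3, h4⟩ := hB
  refine ⟨Z * W, ?_, fun i => ?_⟩
  -- Telescoping gives one low-rank term per factor, so the ranks add.
  · have : A * B - Z * W = (A - Z) * B + Z * (B - W) := by noncomm_ring
    rw [this]
    have h5 := Matrix.rank_add_le_add ((A - Z) * B) (Z * (B - W))
    have h6 := Matrix.rank_mul_le_left (A - Z) B
    have h7 := Matrix.rank_mul_le_right Z (B - W)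
    have : ((((A - Z) * B + Z * (B - W)).rank : ℕ) : ℝ) ≤ (A - Z).rank + (B - W).rank := by
      exact_mod_cast h5.trans (add_le_add h6 h7)
    linarith
  · have hsub : {j | (Z * W) i j ≠ 0} ⊆
        ((Finset.univ.filter fun l => Z i l ≠ 0).biUnion
          fun l => Finset.univ.filter fun j => W l j ≠ 0 : Finset X) := by
      intro j hj
      obtain ⟨l, -, hl⟩ := Finset.exists_ne_zero_of_sum_ne_zero
        (show ∑ l, Z i l * W l j ≠ 0 by simpa [Matrix.mul_apply] using hj)
      simp only [Finset.coe_biUnion, Set.mem_iUnion]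
      exact ⟨l, by simpa using left_ne_zero_of_mul hl, by simpa using right_ne_zero_of_mul hl⟩
    have hc := Set.ncard_le_ncard hsub (Set.toFinite _)
    rw [Set.ncard_coe_finset] at hc
    have h2' := h2 i
    have key : ∀ (V : Matrix X X 𝔽) (l : X),
        {j | V l j ≠ 0}.ncard = (Finset.univ.filter fun j => V l j ≠ 0).card := by
      intro V l
      rw [← Set.ncard_coe_finset]; congr 1; ext; simp
    rw [key] at h2'
    calc ({j | (Z * W) i j ≠ 0}.ncard : ℝ)
        ≤ (∑ l ∈ Finset.univ.filter fun l => Z i l ≠ 0,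
            (Finset.univ.filter fun j => W l j ≠ 0).card : ℕ) := by
          exact_mod_cast hc.trans Finset.card_biUnion_le
      _ ≤ ∑ l ∈ Finset.univ.filter fun l => Z i l ≠ 0, τ₂ := by
          push_cast
          exact Finset.sum_le_sum fun l _ => by rw [← key]; exact h4 l
      _ ≤ τ₁ * τ₂ := by
          rw [Finset.sum_const, nsmul_eq_mul]
          gcongr

/-- Mixing two approximations of the second factor. -/
theorem kronecker_mix {A : Matrix X X 𝔽} {B : Matrix Y Y 𝔽} {ρ₁ τ₁ ρ τ ρ' τ' : ℝ}
    (hA : NonRigid A ρ₁ τ₁) (hB : NonRigid B ρ τ) (hB' : NonRigid B ρ' τ') (hρ₁ : 0 ≤ ρ₁)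
    (hτ₁ : 0 ≤ τ₁) :
    NonRigid (A ⊗ₖ B) (ρ + ρ₁ * ρ') (τ₁ * τ + Fintype.card X * τ') := by
  classical
  obtain ⟨S, h1, h2⟩ := hA
  obtain ⟨Z, h3, h4⟩ := hB
  obtain ⟨Z', h5, h6⟩ := hB'
  -- The sparse part `S` is paired with one approximation of `B` and the low-rank part `A - S` with
  -- the other. The rank of `S` and the row sparsity of `A - S` are only bounded trivially, by the
  -- order.
  refine ⟨S ⊗ₖ Z + (A - S) ⊗ₖ Z', ?_, fun i => ?_⟩
  · have : A ⊗ₖ B - (S ⊗ₖ Z + (A - S) ⊗ₖ Z') = S ⊗ₖ (B - Z) + (A - S) ⊗ₖ (B - Z') := by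
      ext ⟨i, i'⟩ ⟨j, j'⟩
      simp [Matrix.kroneckerMap_apply]
      ring
    rw [this]
    have h7 := Matrix.rank_add_le_add (S ⊗ₖ (B - Z)) ((A - S) ⊗ₖ (B - Z'))
    have h8 := (Matrix.rank_kronecker_le S (B - Z)).trans
      (Nat.mul_le_mul_right _ (Matrix.rank_le_card_width S))
    have h9 := Matrix.rank_kronecker_le (A - S) (B - Z')
    have : ((S ⊗ₖ (B - Z) + (A - S) ⊗ₖ (B - Z')).rank : ℝ)
        ≤ Fintype.card X * (B - Z).rank + (A - S).rank * (B - Z').rank := by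
      exact_mod_cast h7.trans (add_le_add h8 h9)
    rw [Fintype.card_prod]
    push_cast
    calc _ ≤ _ := this
      _ ≤ Fintype.card X * (ρ * Fintype.card Y)
          + (ρ₁ * Fintype.card X) * (ρ' * Fintype.card Y) := by gcongr
      _ = _ := by ring
  · have hsub : {j | (S ⊗ₖ Z + (A - S) ⊗ₖ Z') i j ≠ 0} ⊆
        {j | S i.1 j ≠ 0} ×ˢ {j | Z i.2 j ≠ 0} ∪ Set.univ ×ˢ {j | Z' i.2 j ≠ 0} := by
      rintro ⟨j, j'⟩ hj
      by_contra hcon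
      simp only [Set.mem_union, Set.mem_prod, Set.mem_ofPred_eq, Set.mem_univ, true_and,
        not_or, not_and_or, not_not] at hcon
      obtain ⟨ha, hb⟩ := hcon
      apply hj
      rcases ha with ha | ha <;> simp [Matrix.kroneckerMap_apply, ha, hb]
    have hc := (Set.ncard_le_ncard hsub (Set.toFinite _)).trans (Set.ncard_union_le _ _)
    rw [Set.ncard_prod, Set.ncard_prod, Set.ncard_univ, Nat.card_eq_fintype_card] at hc
    have hc' : ({j | (S ⊗ₖ Z + (A - S) ⊗ₖ Z') i j ≠ 0}.ncard : ℝ) ≤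
        {j | S i.1 j ≠ 0}.ncard * {j | Z i.2 j ≠ 0}.ncard
          + Fintype.card X * {j | Z' i.2 j ≠ 0}.ncard := by exact_mod_cast hc
    refine hc'.trans ?_
    have := h2 i.1
    have := h4 i.2
    have := h6 i.2
    gcongr

theorem kronecker {A : Matrix X X 𝔽} {B : Matrix Y Y 𝔽} {ρ₁ τ₁ ρ₂ τ₂ : ℝ}
    (hA : NonRigid A ρ₁ τ₁) (hB : NonRigid B ρ₂ τ₂) (hρ₁ : 0 ≤ ρ₁) (hτ₁ : 0 ≤ τ₁) :
    NonRigid (A ⊗ₖ B) (ρ₁ + ρ₂) (τ₁ * τ₂) :=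
  (hA.kronecker_mix hB (trivial B le_rfl) hρ₁ hτ₁).mono (by linarith) (by simp)

end NonRigid

/-- The Kronecker product of a finite family of square matrices, indexed by tuples. -/
def Matrix.piKronecker {𝔽 ι : Type*} [Field 𝔽] [Fintype ι] {X : ι → Type*}
    (A : ∀ i, Matrix (X i) (X i) 𝔽) : Matrix (∀ i, X i) (∀ i, X i) 𝔽 :=
  Matrix.of fun x y => ∏ i, A i (x i) (y i)

/-! ### Kronecker products indexed by tuples. -/

section PiKronecker

variable {𝔽 ι : Type*} [Field 𝔽] [Fintype ι] [DecidableEq ι] {X : ι → Type*} [∀ i, Fintype (X i)]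

open Matrix

theorem Matrix.piKronecker_mul (A B : ∀ i, Matrix (X i) (X i) 𝔽) :
    piKronecker (fun i => A i * B i) = piKronecker A * piKronecker B := by
  ext x y
  simp only [piKronecker, Matrix.mul_apply, Matrix.of_apply, ← Finset.prod_mul_distrib]
  rw [Finset.prod_univ_sum, Fintype.piFinset_univ]

theorem NonRigid.piKronecker_diagonal [∀ i, DecidableEq (X i)] (D : ∀ i, X i → 𝔽) :
    NonRigid (piKronecker fun i => diagonal (D i)) 0 1 := by
  refine ⟨piKronecker fun i => diagonal (D i), by simp, fun x => ?_⟩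
  have : {y | piKronecker (fun i => diagonal (D i)) x y ≠ 0} ⊆ {x} := by
    intro y hy
    rw [Set.mem_singleton_iff]
    funext i
    by_contra hne
    refine hy (Finset.prod_eq_zero (Finset.mem_univ i) ?_)
    exact diagonal_apply_ne _ (Ne.symm hne)
  exact_mod_cast (Set.ncard_le_ncard this).trans (Set.ncard_singleton x).le

end PiKronecker

/-! ### Concentration and counting by exponential moments. -/

section ExponentialMoment

variable {ι : Type*} [Fintype ι] [DecidableEq ι] {X : ι → Type*} [∀ i, Fintype (X i)]
  [∀ i, DecidableEq (X i)]

/-- `1` at `p`, `-1` at `q`, and `0` elsewhere (in particular everywhere if `p = q`). -/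
def signWeight {X : Type*} [DecidableEq X] (p q x : X) : ℝ :=
  (if x = p then 1 else 0) - (if x = q then 1 else 0)

theorem signWeight_swap {X : Type*} [DecidableEq X] (p q x : X) :
    signWeight q p x = -signWeight p q x := by
  simp [signWeight]

theorem sum_exp_signWeight_le {X : Type*} [Fintype X] [DecidableEq X] (p q : X) (t : ℝ) :
    ∑ x, Real.exp (t * signWeight p q x) ≤ Fintype.card X * Real.exp (t ^ 2 / 2) := by
  have h1 : (1 : ℝ) ≤ Real.exp (t ^ 2 / 2) := Real.one_le_exp (by positivity)
  rcases eq_or_ne p q with rfl | hpq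
  · simp only [signWeight, sub_self, mul_zero, Real.exp_zero, Finset.sum_const, Finset.card_univ,
      nsmul_eq_mul]
    gcongr
  -- Only `p` and `q` differ from the constant term; together they contribute 2 cosh t ≤ 2
  -- exp(t²/2).
  · have key : ∀ x, Real.exp (t * signWeight p q x) - Real.exp (t ^ 2 / 2) ≤
        (if x = p then Real.exp t - Real.exp (t ^ 2 / 2) else 0) +
        (if x = q then Real.exp (-t) - Real.exp (t ^ 2 / 2) else 0) := by
      intro x
      by_cases hp : x = p
      · subst hp; simp [signWeight, hpq]
      · by_cases hq : x = q
        · subst hq; simp [signWeight, hp]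
        · simp [signWeight, hp, hq, h1]
    have h2 := Finset.sum_le_sum fun x (_ : x ∈ Finset.univ) => key x
    rw [Finset.sum_sub_distrib, Finset.sum_add_distrib, Finset.sum_ite_eq', Finset.sum_ite_eq'] at h2
    simp only [Finset.sum_const, Finset.card_univ, nsmul_eq_mul, Finset.mem_univ, if_true] at h2
    have h3 := Real.cosh_le_exp_half_sq t
    rw [Real.cosh_eq] at h3
    linarith

/-- Chernoff bound for independent mean-zero signs. The tilt is taken equal to `δ`, which minimises
t²/2 - tδ. -/
theorem card_signWeight_ge_le (p q : ∀ i, X i) (δ : ℝ) (hδ : 0 ≤ δ) :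
    (Fintype.card {x : ∀ i, X i // δ * Fintype.card ι ≤ ∑ i, signWeight (p i) (q i) (x i)} : ℝ) ≤
      Real.exp (-(δ ^ 2 / 2 * Fintype.card ι)) * Fintype.card (∀ i, X i) := by
  classical
  set k : ℝ := (Fintype.card ι : ℝ) with hk
  have h1 : (Fintype.card {x : ∀ i, X i // δ * k ≤ ∑ i, signWeight (p i) (q i) (x i)} : ℝ) ≤
      ∑ x : ∀ i, X i, Real.exp (δ * (∑ i, signWeight (p i) (q i) (x i)) - δ ^ 2 * k) := by
    rw [Fintype.card_subtype, Finset.card_eq_sum_ones, Finset.sum_filter]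
    push_cast
    refine Finset.sum_le_sum fun x _ => ?_
    split_ifs with h
    · exact Real.one_le_exp (by nlinarith)
    · positivity
  have h2 : ∑ x : ∀ i, X i, Real.exp (δ * (∑ i, signWeight (p i) (q i) (x i)) - δ ^ 2 * k) =
      Real.exp (-(δ ^ 2 * k)) * ∏ i, ∑ a, Real.exp (δ * signWeight (p i) (q i) a) := by
    rw [Finset.prod_univ_sum, Fintype.piFinset_univ, Finset.mul_sum]
    refine Finset.sum_congr rfl fun x _ => ?_
    rw [← Real.exp_sum, ← Real.exp_add, ← Finset.mul_sum]
    ring_nf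
  have h3 : ∏ i, ∑ a, Real.exp (δ * signWeight (p i) (q i) a) ≤
      ∏ i, (Fintype.card (X i) * Real.exp (δ ^ 2 / 2)) :=
    Finset.prod_le_prod (fun i _ => by positivity) fun i _ => sum_exp_signWeight_le _ _ _
  rw [Finset.prod_mul_distrib, Finset.prod_const, Finset.card_univ, ← Real.exp_nat_mul, ← hk] at h3
  rw [Fintype.card_pi, Nat.cast_prod]
  calc _ ≤ _ := h1
    _ = _ := h2
    _ ≤ Real.exp (-(δ ^ 2 * k)) * ((∏ i, (Fintype.card (X i) : ℝ)) * Real.exp (k * (δ ^ 2 / 2))) := by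
        gcongr
    _ = (Real.exp (-(δ ^ 2 * k)) * Real.exp (k * (δ ^ 2 / 2))) * ∏ i, (Fintype.card (X i) : ℝ) := by
        ring
    _ = _ := by
        rw [← Real.exp_add]
        ring_nf

/-- A crude bound for the number of subsets of size less than `δ k`. -/
theorem card_small_finsets_le (ι : Type*) [Fintype ι] (δ t : ℝ) (ht : 0 ≤ t) :
    (Fintype.card {U : Finset ι // (U.card : ℝ) < δ * Fintype.card ι} : ℝ) ≤
      Real.exp ((t * δ + Real.exp (-t)) * Fintype.card ι) := by
  classical
  set k := Fintype.card ι with hk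
  -- Each small set is charged exp(t(δk - |U|)) ≥ 1; summing over all sets gives (1 + exp(-t))^k.
  have h1 : (Fintype.card {U : Finset ι // (U.card : ℝ) < δ * k} : ℝ) ≤
      ∑ U : Finset ι, Real.exp (t * δ * k) * Real.exp (-t) ^ U.card := by
    rw [Fintype.card_subtype, Finset.card_eq_sum_ones, Finset.sum_filter]
    push_cast
    refine Finset.sum_le_sum fun U _ => ?_
    split_ifs with h
    · rw [← Real.exp_nat_mul, ← Real.exp_add]
      exact Real.one_le_exp (by nlinarith)
    · positivity
  refine h1.trans ?_
  rw [← Finset.mul_sum]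
  have h2 := Fintype.sum_pow_mul_eq_add_pow ι (Real.exp (-t)) 1
  simp only [one_pow, mul_one] at h2
  rw [h2, ← hk, add_mul, Real.exp_add]
  gcongr
  rw [mul_comm (Real.exp (-t)), Real.exp_nat_mul]
  gcongr
  exact Real.add_one_le_exp _

end ExponentialMoment

/-- The transvection with off-diagonal entry `1` at `(p, q)`, or the identity matrix if `p = q`. -/
def unitTransvection (𝔽 : Type*) [Field 𝔽] {X : Type*} [DecidableEq X] (p q : X) : Matrix X X 𝔽 :=
  if p = q then 1 else Matrix.transvection p q 1

/-! ### Kronecker products of unit transvections. -/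

section UnitTransvection

variable {𝔽 : Type*} [Field 𝔽]

open Matrix

/-- The inequality makes deviations from the swap countable. Summed over coordinates, it bounds
their number by an expression in the total weights of x, w and y, each of which is close to zero for
most indices. -/
theorem exists_unitTransvection_factorization {X : Type*} [Fintype X] [DecidableEq X] (p q : X) :
    ∃ F G : Matrix X X 𝔽, F * G = unitTransvection 𝔽 p q ∧ ∀ x w y, F x w ≠ 0 → G w y ≠ 0 →
      (y = x ∨ y = Equiv.swap p q x) ∧
      (if y ≠ Equiv.swap p q x then (1 : ℝ) else 0) ≤
        -signWeight p q w + (signWeight p q y - signWeight p q x) / 2 := by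
  rcases eq_or_ne p q with rfl | hpq
  · refine ⟨1, 1, by simp [unitTransvection], fun x w y h1 h2 => ?_⟩
    have hxw : x = w := by by_contra h; exact h1 (one_apply_ne h)
    have hwy : w = y := by by_contra h; exact h2 (one_apply_ne h)
    subst hxw hwy
    simp [signWeight]
  -- On the coordinates p, q this is [[1,1],[0,1]] = [[0,1],[-1,1]] * [[1,0],[1,1]]; the paths q → q
  -- → p and q → p → p cancel.
  · refine ⟨1 - single p p 1 + single p q 1 - single q p 1, 1 + single q p 1, ?_, ?_⟩
    · have hqp := hpq.symm
      simp only [unitTransvection, hpq, if_false, transvection, mul_add, sub_mul, add_mul, mul_one,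
        one_mul, single_mul_single_same, single_mul_single_of_ne, ne_eq,
        not_false_eq_true]
      abel
    · intro x w y h1 h2
      by_cases hxp : x = p
      · subst hxp
        have hw : w = q := by
          by_contra hw
          apply h1
          by_cases hwx : x = w
          · subst hwx; simp [hpq.symm]
          · simp [one_apply, hwx, Ne.symm hw, hpq.symm]
        subst hw
        have hy : y = x ∨ y = w := by
          by_contra! hy
          exact h2 (by simp [one_apply, hy.1.symm, hy.2.symm])
        rcases hy with rfl | rfl
        · simp [signWeight, hpq, hpq.symm]
        · simp [signWeight, hpq, hpq.symm]; norm_num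
      · by_cases hxq : x = q
        · subst hxq
          have hw : w = x ∨ w = p := by
            by_contra! hw
            exact h1 (by simp [one_apply, hw.1.symm, hw.2.symm, hpq])
          rcases hw with rfl | rfl
          · have hy : y = w ∨ y = p := by
              by_contra! hy
              exact h2 (by simp [one_apply, hy.1.symm, hy.2.symm])
            rcases hy with rfl | rfl
            · simp [signWeight, hpq.symm]
            · simp [signWeight, hpq, hpq.symm]
          · have hy : y = w := by
              by_contra hy
              exact h2 (by simp [one_apply, Ne.symm hy, hpq.symm])
            subst hy
            simp [signWeight, hpq, hpq.symm]
        · have hw : w = x := by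
            by_contra hw
            exact h1 (by simp [one_apply, Ne.symm hw, Ne.symm hxp,
              Ne.symm hxq])
          subst hw
          have hy : y = w := by
            by_contra hy
            exact h2 (by simp [one_apply, Ne.symm hy, Ne.symm hxq])
          subst hy
          simp [Equiv.swap_apply_of_ne_of_ne hxp hxq, signWeight, hxp, hxq]

theorem Matrix.rank_diagonal_indicator {X : Type*} [Fintype X] [DecidableEq X] (P : X → Prop)
    [DecidablePred P] :
    (diagonal fun x => if P x then (1 : 𝔽) else 0).rank = Fintype.card {x // P x} := by
  classical
  rw [Matrix.rank_diagonal]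
  exact Fintype.card_congr (Equiv.subtypeEquivRight fun x => by simp)

variable {ι : Type*} [Fintype ι] [DecidableEq ι] {X : ι → Type*} [∀ i, Fintype (X i)]
  [∀ i, DecidableEq (X i)]

theorem NonRigid.piKronecker_unitTransvection (p q : ∀ i, X i) (δ t : ℝ) (hδ : 0 ≤ δ)
    (ht : 0 ≤ t) :
    NonRigid (piKronecker fun i => unitTransvection 𝔽 (p i) (q i))
      (3 * Real.exp (-(δ ^ 2 / 2 * Fintype.card ι)))
      (Real.exp ((t * (2 * δ) + Real.exp (-t)) * Fintype.card ι)) := by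
  classical
  choose F G hFG hsupp using fun i => exists_unitTransvection_factorization (𝔽 := 𝔽) (p i) (q i)
  set k : ℝ := (Fintype.card ι : ℝ) with hk
  let φ : (∀ i, X i) → ℝ := fun x => ∑ i, signWeight (p i) (q i) (x i)
  let D : Matrix (∀ i, X i) (∀ i, X i) 𝔽 := diagonal fun x => if φ x ≤ -(δ * k) then 1 else 0
  let D' : Matrix (∀ i, X i) (∀ i, X i) 𝔽 := diagonal fun x => if δ * k ≤ φ x then 1 else 0
  set n : ℝ := (Fintype.card (∀ i, X i) : ℝ) with hn
  have hD' : (D'.rank : ℝ) ≤ Real.exp (-(δ ^ 2 / 2 * k)) * n := by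
    rw [Matrix.rank_diagonal_indicator]
    exact card_signWeight_ge_le p q δ hδ
  have hD : (D.rank : ℝ) ≤ Real.exp (-(δ ^ 2 / 2 * k)) * n := by
    rw [Matrix.rank_diagonal_indicator]
    refine le_trans (le_of_eq ?_) (card_signWeight_ge_le q p δ hδ)
    congr 1
    refine Fintype.card_congr (Equiv.subtypeEquivRight fun x => ?_)
    simp only [φ, signWeight_swap (p _) (q _), Finset.sum_neg_distrib]
    exact le_neg
  have hmul : piKronecker (fun i => unitTransvection 𝔽 (p i) (q i)) =
      piKronecker F * piKronecker G := by
    rw [← piKronecker_mul]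
    simp only [hFG]
  -- Delete rows and intermediate indices of very negative weight and columns of very positive
  -- weight. The three deletions cost the ranks of `D`, `D` and `D'`.
  refine ⟨(1 - D) * (piKronecker F * (1 - D) * piKronecker G) * (1 - D'), ?_, fun x => ?_⟩
  · have h1 : piKronecker F * piKronecker G -
        (1 - D) * (piKronecker F * (1 - D) * piKronecker G) * (1 - D') =
        piKronecker F * D * piKronecker G + (D * (piKronecker F * (1 - D) * piKronecker G) +
        ((1 - D) * (piKronecker F * (1 - D) * piKronecker G)) * D') := by
      noncomm_ring
    rw [hmul, h1]
    have h2 := rank_add_le_add (piKronecker F * D * piKronecker G)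
      (D * (piKronecker F * (1 - D) * piKronecker G) +
        ((1 - D) * (piKronecker F * (1 - D) * piKronecker G)) * D')
    have h3 := rank_add_le_add (D * (piKronecker F * (1 - D) * piKronecker G))
      (((1 - D) * (piKronecker F * (1 - D) * piKronecker G)) * D')
    have h4 := (rank_mul_le_left (piKronecker F * D) (piKronecker G)).trans
      (rank_mul_le_right (piKronecker F) D)
    have h5 := rank_mul_le_left D (piKronecker F * (1 - D) * piKronecker G)
    have h6 := rank_mul_le_right ((1 - D) * (piKronecker F * (1 - D) * piKronecker G)) D'
    have h7 := h2.trans (add_le_add h4 (h3.trans (add_le_add h5 h6)))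
    have h8 : (_ : ℝ) ≤ ((D.rank + (D.rank + D'.rank) : ℕ) : ℝ) := Nat.cast_le.2 h7
    push_cast at h8
    linarith
  · have hsub : {y | ((1 - D) * (piKronecker F * (1 - D) * piKronecker G) * (1 - D')) x y ≠ 0} ⊆
        ((Finset.univ.filter fun U : Finset ι => (U.card : ℝ) < 2 * δ * k).image
          fun U i => if i ∈ U then x i else Equiv.swap (p i) (q i) (x i) :
          Finset (∀ i, X i)) := by
      intro y hy
      have hone : ∀ P : (∀ i, X i) → Prop, ∀ [DecidablePred P],
          (1 : Matrix (∀ i, X i) (∀ i, X i) 𝔽) - diagonal (fun x => if P x then 1 else 0) =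
          diagonal fun x => if P x then 0 else 1 := by
        intro P _
        rw [← diagonal_one, diagonal_sub]
        congr 1
        funext z
        split_ifs <;> simp
      rw [Set.mem_ofPred_eq, hone, hone, mul_diagonal, diagonal_mul] at hy
      have hy2 := right_ne_zero_of_mul hy
      have hx := left_ne_zero_of_mul (left_ne_zero_of_mul hy)
      have hxy := right_ne_zero_of_mul (left_ne_zero_of_mul hy)
      obtain ⟨w, -, hw⟩ := Finset.exists_ne_zero_of_sum_ne_zero hxy
      beta_reduce at hw
      rw [mul_diagonal] at hw
      have hFx := left_ne_zero_of_mul (left_ne_zero_of_mul hw)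
      have hw2 := right_ne_zero_of_mul (left_ne_zero_of_mul hw)
      have hGy := right_ne_zero_of_mul hw
      have hx' : ¬ φ x ≤ -(δ * k) := fun h => hx (if_pos h)
      have hw' : ¬ φ w ≤ -(δ * k) := fun h => hw2 (if_pos h)
      have hy' : ¬ δ * k ≤ φ y := fun h => hy2 (if_pos h)
      have hF : ∀ i, F i (x i) (w i) ≠ 0 := fun i => Finset.prod_ne_zero_iff.1 hFx i (by simp)
      have hG : ∀ i, G i (w i) (y i) ≠ 0 := fun i => Finset.prod_ne_zero_iff.1 hGy i (by simp)
      have hs := fun i => hsupp i _ _ _ (hF i) (hG i)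
      rw [Finset.mem_coe, Finset.mem_image]
      -- Given x, the deviation set determines y. On surviving paths its size is below δk + (δk +
      -- δk)/2 = 2δk.
      refine ⟨Finset.univ.filter fun i => y i ≠ Equiv.swap (p i) (q i) (x i), ?_, ?_⟩
      · rw [Finset.mem_filter]
        refine ⟨Finset.mem_univ _, ?_⟩
        have h1 := Finset.sum_le_sum fun i (_ : i ∈ Finset.univ) => (hs i).2
        rw [Finset.sum_add_distrib, Finset.sum_neg_distrib, ← Finset.sum_div,
          Finset.sum_sub_distrib, Finset.sum_boole] at h1
        change _ ≤ -φ w + (φ y - φ x) / 2 at h1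
        linarith
      · funext i
        by_cases h : y i = Equiv.swap (p i) (q i) (x i)
        · simp [h]
        · simp only [Finset.mem_filter, Finset.mem_univ, true_and, ne_eq, h, not_false_eq_true,
            if_true]
          exact ((hs i).1.resolve_right h).symm
    have hc := (Set.ncard_le_ncard hsub (Set.toFinite _))
    rw [Set.ncard_coe_finset] at hc
    refine le_trans ?_ (card_small_finsets_le ι (2 * δ) t ht)
    rw [Fintype.card_subtype]
    exact_mod_cast hc.trans Finset.card_image_le

end UnitTransvection

/-! ### Gaussian elimination with a count of transvections. -/

section Pivot

variable {𝔽 : Type*} [Field 𝔽]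

open Matrix Matrix.TransvectionStruct Sum

/-- Two-sided reduction to diagonal form with at most `m` transvections on each side. -/
def DiagonalizableIn (m : ℕ) {n : Type*} [Fintype n] [DecidableEq n] (M : Matrix n n 𝔽) : Prop :=
  ∃ (L L' : List (TransvectionStruct n 𝔽)) (D : n → 𝔽), L.length ≤ m ∧ L'.length ≤ m ∧
    (L.map toMatrix).prod * M * (L'.map toMatrix).prod = diagonal D

theorem exists_isTwoBlockDiagonal_length_of_ne_zero {r : ℕ}
    (M : Matrix (Fin r ⊕ Unit) (Fin r ⊕ Unit) 𝔽) (hM : M (inr ()) (inr ()) ≠ 0) :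
    ∃ L L' : List (TransvectionStruct (Fin r ⊕ Unit) 𝔽), L.length ≤ r ∧ L'.length ≤ r ∧
      IsTwoBlockDiagonal ((L.map toMatrix).prod * M * (L'.map toMatrix).prod) := by
  let L : List (TransvectionStruct (Fin r ⊕ Unit) 𝔽) :=
    List.ofFn fun i : Fin r => ⟨inl i, inr (), by simp, -M (inl i) (inr ()) / M (inr ()) (inr ())⟩
  let L' : List (TransvectionStruct (Fin r ⊕ Unit) 𝔽) :=
    List.ofFn fun i : Fin r => ⟨inr (), inl i, by simp, -M (inr ()) (inl i) / M (inr ()) (inr ())⟩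
  have h : L.map toMatrix = Pivot.listTransvecCol M := by
    simp [L, Pivot.listTransvecCol, Function.comp_def]
  have h' : L'.map toMatrix = Pivot.listTransvecRow M := by
    simp [L', Pivot.listTransvecRow, Function.comp_def]
  refine ⟨L, L', by simp [L], by simp [L'], ?_⟩
  rw [h, h']
  exact Pivot.isTwoBlockDiagonal_listTransvecCol_mul_mul_listTransvecRow M hM

/-- The extra transvection brings a nonzero entry to the pivot when the corner vanishes; clearing
the last row and column takes r on each side. -/
theorem exists_isTwoBlockDiagonal_length {r : ℕ} (M : Matrix (Fin r ⊕ Unit) (Fin r ⊕ Unit) 𝔽) :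
    ∃ L L' : List (TransvectionStruct (Fin r ⊕ Unit) 𝔽), L.length ≤ r + 1 ∧ L'.length ≤ r + 1 ∧
      IsTwoBlockDiagonal ((L.map toMatrix).prod * M * (L'.map toMatrix).prod) := by
  by_cases H : IsTwoBlockDiagonal M
  · exact ⟨[], [], by simp, by simp, by simpa using H⟩
  by_cases hM : M (inr ()) (inr ()) = 0; swap
  · obtain ⟨L, L', h, h', hL⟩ := exists_isTwoBlockDiagonal_length_of_ne_zero M hM
    exact ⟨L, L', by omega, by omega, hL⟩
  have : ∃ i : Fin r, M (inl i) (inr ()) ≠ 0 ∨ M (inr ()) (inl i) ≠ 0 := by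
    by_contra! hcon
    apply H
    constructor
    · ext i ⟨⟩
      exact (hcon i).1
    · ext ⟨⟩ i
      exact (hcon i).2
  obtain ⟨i, h | h⟩ := this
  · let M' := transvection (inr ()) (inl i) 1 * M
    have hM' : M' (inr ()) (inr ()) ≠ 0 := by simpa [M', hM]
    obtain ⟨L, L', hl, hl', hLL'⟩ := exists_isTwoBlockDiagonal_length_of_ne_zero M' hM'
    rw [Matrix.mul_assoc] at hLL'
    refine ⟨L ++ [⟨inr (), inl i, by simp, 1⟩], L', by simpa using hl, by omega, ?_⟩
    simp only [List.map_append, List.prod_append, Matrix.mul_one, toMatrix_mk, List.prod_cons,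
      List.prod_nil, List.map, Matrix.mul_assoc (L.map toMatrix).prod]
    exact hLL'
  · let M' := M * transvection (inl i) (inr ()) 1
    have hM' : M' (inr ()) (inr ()) ≠ 0 := by simpa [M', hM]
    obtain ⟨L, L', hl, hl', hLL'⟩ := exists_isTwoBlockDiagonal_length_of_ne_zero M' hM'
    refine ⟨L, ⟨inl i, inr (), by simp, 1⟩ :: L', by omega, by simpa using hl', ?_⟩
    simp only [← Matrix.mul_assoc, toMatrix_mk, List.prod_cons, List.map]
    rw [Matrix.mul_assoc (L.map toMatrix).prod]
    exact hLL'

theorem DiagonalizableIn.step {r m : ℕ}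
    (IH : ∀ M : Matrix (Fin r) (Fin r) 𝔽, DiagonalizableIn m M)
    (M : Matrix (Fin r ⊕ Unit) (Fin r ⊕ Unit) 𝔽) : DiagonalizableIn (m + (r + 1)) M := by
  obtain ⟨L₁, L₁', hl₁, hl₁', hM⟩ := exists_isTwoBlockDiagonal_length M
  let M' := (L₁.map toMatrix).prod * M * (L₁'.map toMatrix).prod
  let M'' := toBlocks₁₁ M'
  obtain ⟨L₀, L₀', D₀, hl₀, hl₀', h₀⟩ := IH M''
  set c := M' (inr ()) (inr ())
  refine ⟨L₀.map (sumInl Unit) ++ L₁, L₁' ++ L₀'.map (sumInl Unit),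
    Sum.elim D₀ fun _ => M' (inr ()) (inr ()), by simp; omega, by simp; omega, ?_⟩
  suffices (L₀.map (toMatrix ∘ sumInl Unit)).prod * M' * (L₀'.map (toMatrix ∘ sumInl Unit)).prod =
      diagonal (Sum.elim D₀ fun _ => c) by
    simpa [M', c, Matrix.mul_assoc]
  have : M' = fromBlocks M'' 0 0 (diagonal fun _ => c) := by
    rw [← fromBlocks_toBlocks M', hM.1, hM.2]
    rfl
  rw [this]
  simp [h₀]

theorem DiagonalizableIn.reindex {m : ℕ} {n p : Type*} [Fintype n] [DecidableEq n] [Fintype p]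
    [DecidableEq p] (M : Matrix p p 𝔽) (e : p ≃ n)
    (H : DiagonalizableIn m (reindexAlgEquiv 𝔽 _ e M)) : DiagonalizableIn m M := by
  obtain ⟨L₀, L₀', D₀, h, h', h₀⟩ := H
  refine ⟨L₀.map (reindexEquiv e.symm), L₀'.map (reindexEquiv e.symm), D₀ ∘ e, by simpa using h,
    by simpa using h', ?_⟩
  have : M = reindexAlgEquiv 𝔽 _ e.symm (reindexAlgEquiv 𝔽 _ e M) := by simp
  rw [this]
  simp_rw [List.map_map, toMatrix_reindexEquiv_prod, ← map_mul, h₀]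
  simp

theorem diagonalizableIn_sq (d : ℕ) (M : Matrix (Fin d) (Fin d) 𝔽) :
    DiagonalizableIn (d ^ 2) M := by
  induction d with
  | zero => exact ⟨[], [], fun _ => 1, by simp, by simp, by ext i; exact i.elim0⟩
  | succ r IH =>
    have e : Fin (r + 1) ≃ Fin r ⊕ Unit := Fintype.equivOfCardEq (by simp)
    apply DiagonalizableIn.reindex M e
    obtain ⟨L, L', D, h, h', h₀⟩ := DiagonalizableIn.step IH (reindexAlgEquiv 𝔽 _ e M)
    -- The count closes because r² + (r + 1) ≤ (r + 1)².
    exact ⟨L, L', D, by nlinarith, by nlinarith, h₀⟩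

end Pivot

/-! ### Exponential saving for factors of bounded order. -/

section Tensor

open Matrix Pointwise

variable {𝔽 : Type*} [Field 𝔽]

/-- Kronecker products of `k` members of `S` are non-rigid, with a saving exponential in `k`. -/
def TensorNonRigid (S : ∀ d : ℕ, Set (Matrix (Fin d) (Fin d) 𝔽)) : Prop :=
  ∀ ε : ℝ, 0 < ε → ∃ C γ : ℝ, 0 ≤ C ∧ 0 < γ ∧ ∀ (k : ℕ) (d : Fin k → ℕ)
    (A : ∀ i, Matrix (Fin (d i)) (Fin (d i)) 𝔽), (∀ i, A i ∈ S (d i)) →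
      NonRigid (piKronecker A) (C * Real.exp (-(γ * k))) (Real.exp (ε * k))

/-- By the mixed-product rule a factorwise product becomes a product of Kronecker products, so
`NonRigid.mul` applies with half the exponent on each side. -/
theorem TensorNonRigid.mul {S T : ∀ d : ℕ, Set (Matrix (Fin d) (Fin d) 𝔽)}
    (hS : TensorNonRigid S) (hT : TensorNonRigid T) : TensorNonRigid fun d => S d * T d := by
  intro ε hε
  obtain ⟨C, γ, hC, hγ, h⟩ := hS (ε / 2) (by positivity)
  obtain ⟨C', γ', hC', hγ', h'⟩ := hT (ε / 2) (by positivity)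
  refine ⟨C + C', min γ γ', by positivity, by positivity, fun k d A hA => ?_⟩
  choose B hB B' hB' hBB' using fun i => Set.mem_mul.1 (hA i)
  have : A = fun i => B i * B' i := funext fun i => (hBB' i).symm
  rw [this, piKronecker_mul]
  refine ((h k d B hB).mul (h' k d B' hB')).mono ?_ (le_of_eq ?_)
  · rw [add_mul]
    gcongr
    · exact min_le_left _ _
    · exact min_le_right _ _
  · rw [← Real.exp_add]
    ring_nf

variable (𝔽) in
/-- The diagonal matrices. -/
def diagonalSet (d : ℕ) : Set (Matrix (Fin d) (Fin d) 𝔽) := Set.range diagonal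

variable (𝔽) in
/-- The unit transvections, including the identity. -/
def unitTransvectionSet (d : ℕ) : Set (Matrix (Fin d) (Fin d) 𝔽) :=
  {A | ∃ p q, unitTransvection 𝔽 p q = A}

theorem tensorNonRigid_diagonalSet : TensorNonRigid (diagonalSet 𝔽) := by
  intro ε hε
  refine ⟨0, 1, le_rfl, one_pos, fun k d A hA => ?_⟩
  choose D hD using hA
  rw [← funext hD]
  exact (NonRigid.piKronecker_diagonal D).mono (by simp) (Real.one_le_exp (by positivity))

theorem tensorNonRigid_unitTransvectionSet : TensorNonRigid (unitTransvectionSet 𝔽) := by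
  intro ε hε
  -- `t` makes exp(-t) ≤ ε/2, and `δ` below is then so small that 2δt ≤ ε/2; the two add up to the
  -- exponent ε.
  let t := max 0 (-Real.log (ε / 2))
  have ht : 0 ≤ t := le_max_left _ _
  have ht' : Real.exp (-t) ≤ ε / 2 := by
    rw [← Real.le_log_iff_exp_le (by positivity)]
    linarith [le_max_right 0 (-Real.log (ε / 2))]
  let δ := ε / (4 * (t + 1))
  have hδ : 0 < δ := by positivity
  have hδ' : t * (2 * δ) ≤ ε / 2 := by
    have : (t + 1) * (2 * δ) = ε / 2 := by simp only [δ]; field_simp; norm_num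
    nlinarith
  refine ⟨3, δ ^ 2 / 2, by norm_num, by positivity, fun k d A hA => ?_⟩
  choose p q hpq using hA
  rw [← funext hpq]
  refine (NonRigid.piKronecker_unitTransvection p q δ t hδ.le ht).mono ?_ ?_
  · rw [Fintype.card_fin]
  · rw [Fintype.card_fin]
    gcongr
    linarith

variable (𝔽) in
/-- Products `D * T * D'` with `D, D'` diagonal and `T` a unit transvection. -/
def elementarySet (d : ℕ) : Set (Matrix (Fin d) (Fin d) 𝔽) :=
  diagonalSet 𝔽 d * unitTransvectionSet 𝔽 d * diagonalSet 𝔽 d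

theorem tensorNonRigid_elementarySet_pow (m : ℕ) :
    TensorNonRigid fun d => elementarySet 𝔽 d ^ m := by
  induction m with
  | zero =>
    intro ε hε
    obtain ⟨C, γ, hC, hγ, h⟩ := tensorNonRigid_diagonalSet (𝔽 := 𝔽) ε hε
    refine ⟨C, γ, hC, hγ, fun k d A hA => h k d A fun i => ?_⟩
    have : A i ∈ elementarySet 𝔽 (d i) ^ 0 := hA i
    rw [pow_zero, Set.mem_one] at this
    exact ⟨fun _ => 1, by rw [this, diagonal_one]⟩
  | succ m ih =>
    simp only [pow_succ]
    exact ih.mul ((tensorNonRigid_diagonalSet.mul tensorNonRigid_unitTransvectionSet).mul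
      tensorNonRigid_diagonalSet)

theorem one_mem_diagonalSet (d : ℕ) : 1 ∈ diagonalSet 𝔽 d := ⟨fun _ => 1, diagonal_one⟩

theorem diagonal_mem_elementarySet {d : ℕ} (hd : 0 < d) (D : Fin d → 𝔽) :
    diagonal D ∈ elementarySet 𝔽 d := by
  refine Set.mem_mul.2 ⟨1, Set.mem_mul.2 ⟨1, one_mem_diagonalSet d, 1, ?_, one_mul 1⟩, diagonal D,
    ⟨D, rfl⟩, one_mul _⟩
  exact ⟨⟨0, hd⟩, ⟨0, hd⟩, by simp [unitTransvection]⟩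

theorem transvection_mem_elementarySet {d : ℕ} (t : TransvectionStruct (Fin d) 𝔽) :
    t.toMatrix ∈ elementarySet 𝔽 d := by
  obtain ⟨p, q, hpq, c⟩ := t
  rcases eq_or_ne c 0 with rfl | hc
  · have := diagonal_mem_elementarySet (𝔽 := 𝔽) p.pos fun _ => 1
    simpa using this
  -- Conjugation by a diagonal matrix turns the entry 1 into `c`, which makes the constants
  -- independent of the field.
  · refine Set.mem_mul.2 ⟨_, Set.mem_mul.2 ⟨diagonal (Function.update 1 p c), ⟨_, rfl⟩,
      unitTransvection 𝔽 p q, ⟨p, q, rfl⟩, rfl⟩, diagonal (Function.update 1 p c⁻¹), ⟨_, rfl⟩, ?_⟩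
    ext x y
    rw [mul_diagonal, diagonal_mul, unitTransvection, if_neg hpq, TransvectionStruct.toMatrix_mk,
      transvection, transvection, Matrix.add_apply, Matrix.add_apply, one_apply, single_apply, single_apply]
    by_cases hx : x = p
    · subst hx
      by_cases hy : x = y
      · subst hy
        simp [hc, hpq.symm]
      · by_cases hy' : q = y
        · subst hy'
          simp [hpq, hpq.symm]
        · simp [hy, hy']
    · by_cases hy : x = y
      · subst hy
        simp [hx, Ne.symm hx]
      · simp [hy, Ne.symm hx]

theorem one_mem_elementarySet {d : ℕ} (hd : 0 < d) : 1 ∈ elementarySet 𝔽 d := by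
  rw [← diagonal_one]
  exact diagonal_mem_elementarySet hd _

theorem mem_elementarySet_pow {d : ℕ} (hd : 0 < d) (M : Matrix (Fin d) (Fin d) 𝔽) :
    M ∈ elementarySet 𝔽 d ^ (2 * d ^ 2 + 1) := by
  obtain ⟨L, L', D, hl, hl', h⟩ := diagonalizableIn_sq d M
  have key : ∀ l : List (TransvectionStruct (Fin d) 𝔽), l.length ≤ d ^ 2 →
      (l.map TransvectionStruct.toMatrix).prod ∈ elementarySet 𝔽 d ^ (d ^ 2) := by
    intro l hl
    refine Set.pow_subset_pow_right (one_mem_elementarySet hd) hl ?_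
    clear hl
    induction l with
    | nil => simp
    | cons t l ih =>
      rw [List.map_cons, List.prod_cons, List.length_cons, pow_succ']
      exact Set.mul_mem_mul (transvection_mem_elementarySet t) ih
  have hM : M = (((L.reverse.map TransvectionStruct.inv).map TransvectionStruct.toMatrix).prod *
      diagonal D) *
      ((L'.reverse.map TransvectionStruct.inv).map TransvectionStruct.toMatrix).prod := by
    have h1 := TransvectionStruct.reverse_inv_prod_mul_prod L
    have h2 := TransvectionStruct.prod_mul_reverse_inv_prod L'
    rw [List.map_map, List.map_map, ← h]
    calc M = ((L.reverse.map (TransvectionStruct.toMatrix ∘ TransvectionStruct.inv)).prod *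
        (L.map TransvectionStruct.toMatrix).prod) * M * ((L'.map TransvectionStruct.toMatrix).prod *
        (L'.reverse.map (TransvectionStruct.toMatrix ∘ TransvectionStruct.inv)).prod) := by
          rw [h1, h2, one_mul, mul_one]
      _ = _ := by simp only [mul_assoc]
  have : 2 * d ^ 2 + 1 = d ^ 2 + 1 + d ^ 2 := by ring
  rw [hM, this, pow_add, pow_add, pow_one]
  exact Set.mul_mem_mul (Set.mul_mem_mul (key _ (by simpa using hl))
    (diagonal_mem_elementarySet hd D)) (key _ (by simpa using hl'))

/-- Kronecker products of `k` matrices of bounded size, with a saving exponential in `k`. -/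
theorem NonRigid.exists_of_bounded (𝔽 : Type*) [Field 𝔽] (b : ℕ) (ε : ℝ) (hε : 0 < ε) :
    ∃ C γ : ℝ, 0 ≤ C ∧ 0 < γ ∧ ∀ (k : ℕ) (d : Fin k → ℕ)
      (A : ∀ i, Matrix (Fin (d i)) (Fin (d i)) 𝔽), (∀ i, 0 < d i ∧ d i ≤ b) →
        NonRigid (piKronecker A) (C * Real.exp (-(γ * k))) (Real.exp (ε * k)) := by
  obtain ⟨C, γ, hC, hγ, h⟩ := tensorNonRigid_elementarySet_pow (𝔽 := 𝔽) (2 * b ^ 2 + 1) ε hε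
  refine ⟨C, γ, hC, hγ, fun k d A hd => h k d A fun i => ?_⟩
  -- Padding with identity matrices gives all factors the same length, depending only on `b`.
  refine Set.pow_subset_pow_right (one_mem_elementarySet (hd i).1) ?_
    (mem_elementarySet_pow (hd i).1 (A i))
  have := (hd i).2
  gcongr

end Tensor

/-! ### Reordering and regrouping Kronecker factors. -/

section MatEquiv

open Matrix

variable {𝔽 : Type*} [Field 𝔽]

/-- `M` and `N` agree up to a simultaneous relabelling of rows and columns. -/
def MatEquiv {R X Y : Type*} (M : Matrix X X R) (N : Matrix Y Y R) : Prop :=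
  ∃ e : X ≃ Y, ∀ i j, M i j = N (e i) (e j)

namespace MatEquiv

section Equivalence

variable {R X Y Z : Type*} {M : Matrix X X R} {N : Matrix Y Y R} {P : Matrix Z Z R}

theorem refl (M : Matrix X X R) : MatEquiv M M := ⟨Equiv.refl X, fun _ _ => rfl⟩

theorem symm (h : MatEquiv M N) : MatEquiv N M := by
  obtain ⟨e, he⟩ := h
  exact ⟨e.symm, fun i j => by simp [he]⟩

theorem trans (h : MatEquiv M N) (h' : MatEquiv N P) : MatEquiv M P := by
  obtain ⟨e, he⟩ := h
  obtain ⟨f, hf⟩ := h'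
  exact ⟨e.trans f, fun i j => by simp [he, hf]⟩

end Equivalence

variable {X Y Z X' Y' : Type*} {M : Matrix X X 𝔽} {N : Matrix Y Y 𝔽}
  {M' : Matrix X' X' 𝔽} {N' : Matrix Y' Y' 𝔽}

theorem kronecker (h : MatEquiv M N) (h' : MatEquiv M' N') :
    MatEquiv (M ⊗ₖ M') (N ⊗ₖ N') := by
  obtain ⟨e, he⟩ := h
  obtain ⟨f, hf⟩ := h'
  exact ⟨e.prodCongr f, fun i j => by simp [kroneckerMap_apply, he, hf]⟩

theorem kronecker_assoc (M : Matrix X X 𝔽) (N : Matrix Y Y 𝔽) (P : Matrix Z Z 𝔽) :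
    MatEquiv (M ⊗ₖ (N ⊗ₖ P)) ((M ⊗ₖ N) ⊗ₖ P) :=
  ⟨(Equiv.prodAssoc X Y Z).symm, fun i j => by simp [kroneckerMap_apply, mul_assoc]⟩

theorem kronecker_left_comm (M : Matrix X X 𝔽) (N : Matrix Y Y 𝔽) (P : Matrix Z Z 𝔽) :
    MatEquiv (M ⊗ₖ (N ⊗ₖ P)) (N ⊗ₖ (M ⊗ₖ P)) :=
  ⟨⟨fun x => (x.2.1, x.1, x.2.2), fun x => (x.2.1, x.1, x.2.2), fun _ => rfl, fun _ => rfl⟩,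
    fun i j => by simp [kroneckerMap_apply, mul_left_comm]⟩

theorem one_kronecker [DecidableEq X] [Unique X] (N : Matrix Y Y 𝔽) :
    MatEquiv N ((1 : Matrix X X 𝔽) ⊗ₖ N) :=
  ⟨(Equiv.uniqueProd Y X).symm, fun i j => by simp [kroneckerMap_apply]⟩

theorem nonRigid [Fintype X] [Fintype Y] (h : MatEquiv M N) {ρ τ : ℝ} (hN : NonRigid N ρ τ) :
    NonRigid M ρ τ := by
  obtain ⟨e, he⟩ := h
  exact hN.of_equiv e he

end MatEquiv

theorem SqMat.matEquiv_kron (A B : SqMat 𝔽) : MatEquiv (A.kron B).2 (A.2 ⊗ₖ B.2) :=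
  ⟨finProdFinEquiv.symm, fun _ _ => rfl⟩

/-- The Kronecker product of a list of square matrices. -/
def kronList (l : List (SqMat 𝔽)) : SqMat 𝔽 := l.foldr SqMat.kron ⟨1, 1⟩

theorem kronList_nil : kronList ([] : List (SqMat 𝔽)) = ⟨1, 1⟩ := rfl

theorem kronList_cons (A : SqMat 𝔽) (l : List (SqMat 𝔽)) :
    kronList (A :: l) = A.kron (kronList l) := rfl

theorem kronList_order (l : List (SqMat 𝔽)) : (kronList l).1 = (l.map Sigma.fst).prod := by
  induction l with
  | nil => rfl
  | cons A l ih => rw [kronList_cons, List.map_cons, List.prod_cons, ← ih]; rfl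

theorem matEquiv_kronList_cons (A : SqMat 𝔽) (l : List (SqMat 𝔽)) :
    MatEquiv (kronList (A :: l)).2 (A.2 ⊗ₖ (kronList l).2) := A.matEquiv_kron _

theorem matEquiv_kronList_of_perm {l l' : List (SqMat 𝔽)} (h : l.Perm l') :
    MatEquiv (kronList l).2 (kronList l').2 := by
  induction h with
  | nil => exact MatEquiv.refl _
  | cons A _ ih =>
    exact (matEquiv_kronList_cons A _).trans
      (((MatEquiv.refl _).kronecker ih).trans (matEquiv_kronList_cons A _).symm)
  | swap A B l =>
    exact (matEquiv_kronList_cons B _).trans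
      (((MatEquiv.refl _).kronecker (matEquiv_kronList_cons A l)).trans
      ((MatEquiv.kronecker_left_comm _ _ _).trans
      (((MatEquiv.refl _).kronecker (matEquiv_kronList_cons B l).symm).trans
      (matEquiv_kronList_cons A _).symm)))
  | trans _ _ ih ih' => exact ih.trans ih'

theorem matEquiv_kronList_append (l l' : List (SqMat 𝔽)) :
    MatEquiv (kronList (l ++ l')).2 ((kronList l).2 ⊗ₖ (kronList l').2) := by
  induction l with
  | nil => exact MatEquiv.one_kronecker (X := Fin 1) _
  | cons A l ih =>
    exact (matEquiv_kronList_cons A _).trans (((MatEquiv.refl _).kronecker ih).trans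
      ((MatEquiv.kronecker_assoc _ _ _).trans
      ((matEquiv_kronList_cons A l).symm.kronecker (MatEquiv.refl _))))

theorem matEquiv_kronList_piKronecker (l : List (SqMat 𝔽)) :
    MatEquiv (kronList l).2 (piKronecker fun i : Fin l.length => (l.get i).2) := by
  induction l with
  | nil =>
    refine ⟨⟨fun _ i => i.elim0, fun _ => (0 : Fin 1), fun i => ?_, fun x => ?_⟩, fun i j => ?_⟩
    · exact Subsingleton.elim (α := Fin 1) _ _
    · funext i; exact i.elim0
    · have : i = j := Subsingleton.elim (α := Fin 1) _ _
      subst this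
      exact (one_apply_eq (n := Fin 1) i).trans (by simp [piKronecker])
  | cons A l ih =>
    refine (matEquiv_kronList_cons A l).trans (((MatEquiv.refl _).kronecker ih).trans ?_)
    refine ⟨Fin.consEquiv fun i : Fin (l.length + 1) => Fin ((A :: l).get i).1, fun i j => ?_⟩
    exact (Fin.prod_univ_succ fun x : Fin (l.length + 1) => ((A :: l).get x).2
      (Fin.consEquiv (fun i : Fin (l.length + 1) => Fin ((A :: l).get i).1) i x)
      (Fin.consEquiv (fun i : Fin (l.length + 1) => Fin ((A :: l).get i).1) j x)).symm

theorem exists_kronList_of_isKroneckerProduct {F : Set (SqMat 𝔽)} {M : SqMat 𝔽}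
    (h : IsKroneckerProduct F M) :
    ∃ l : List (SqMat 𝔽), (∀ A ∈ l, A ∈ F) ∧ (kronList l).1 = M.1 ∧
      MatEquiv M.2 (kronList l).2 := by
  induction h with
  | @single A hA =>
    refine ⟨[A], by simpa using hA, by simp [kronList_order], ?_⟩
    refine MatEquiv.symm ((matEquiv_kronList_cons A []).trans ?_)
    exact ⟨Equiv.prodUnique _ (Fin 1), fun i j => by
      have : i.2 = j.2 := Subsingleton.elim (α := Fin 1) _ _
      change A.2 i.1 j.1 * (1 : Matrix (Fin 1) (Fin 1) 𝔽) i.2 j.2 = A.2 i.1 j.1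
      rw [this, show (1 : Matrix (Fin 1) (Fin 1) 𝔽) j.2 j.2 = 1 from one_apply_eq _, mul_one]⟩
  | @kron A B hA _ ih =>
    obtain ⟨l, hl, hl', h⟩ := ih
    refine ⟨A :: l, by simpa using ⟨hA, hl⟩, ?_, ?_⟩
    · rw [kronList_cons]
      exact congrArg (A.1 * ·) hl'
    · exact (A.matEquiv_kron B).trans
        (((MatEquiv.refl _).kronecker h).trans (matEquiv_kronList_cons A l).symm)

theorem NonRigid.kronList_filter_lt (l : List (SqMat 𝔽)) (κ : SqMat 𝔽 → ℕ) (ρ τ : ℕ → ℝ)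
    (hρ : ∀ i, 0 ≤ ρ i) (hτ : ∀ i, 0 ≤ τ i) (m : ℕ)
    (h : ∀ i < m, NonRigid (kronList (l.filter fun A => κ A = i)).2 (ρ i) (τ i)) :
    NonRigid (kronList (l.filter fun A => κ A < m)).2 (∑ i ∈ Finset.range m, ρ i)
      (∏ i ∈ Finset.range m, τ i) := by
  induction m with
  | zero =>
    have : l.filter (fun A => κ A < 0) = [] := by simp
    rw [this]
    exact (NonRigid.self _).mono (by simp) (by rw [Fintype.card_fin]; simp [kronList_nil])
  | succ m ih =>
    have hperm : (l.filter fun A => κ A < m + 1).Perm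
        ((l.filter fun A => κ A < m) ++ l.filter fun A => κ A = m) := by
      have := (List.filter_append_perm (fun A => decide (κ A < m))
        (l.filter fun A => κ A < m + 1)).symm
      rw [List.filter_filter, List.filter_filter] at this
      convert this using 3
      · funext A; simp; omega
      · funext A; rw [Bool.eq_iff_iff]; simp; omega
    rw [Finset.sum_range_succ, Finset.prod_range_succ]
    refine ((matEquiv_kronList_of_perm hperm).trans (matEquiv_kronList_append _ _)).nonRigid ?_
    exact (ih fun i hi => h i (by omega)).kronecker (h m (by omega))
      (Finset.sum_nonneg fun i _ => hρ i) (Finset.prod_nonneg fun i _ => hτ i)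

theorem kronList_filter_lt_order (l : List (SqMat 𝔽)) (κ : SqMat 𝔽 → ℕ) (m : ℕ)
    (h : ∀ A ∈ l, κ A < m) :
    ∏ i ∈ Finset.range m, (kronList (l.filter fun A => κ A = i)).1 = (kronList l).1 := by
  simp only [kronList_order]
  induction l with
  | nil => simp
  | cons A l ih =>
    rw [List.map_cons, List.prod_cons, ← ih fun B hB => h B (by simp [hB])]
    have hA := h A (by simp)
    rw [← Finset.mul_prod_erase _ _ (Finset.mem_range.2 hA),
      ← Finset.mul_prod_erase (Finset.range m) (fun i => ((l.filter fun B => κ B = i).map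
        Sigma.fst).prod) (Finset.mem_range.2 hA), ← mul_assoc]
    congr 1
    · simp
    · refine Finset.prod_congr rfl fun i hi => ?_
      have : ¬ κ A = i := fun h => (Finset.mem_erase.1 hi).1 h.symm
      simp [this]

theorem kronList_order_pos {l : List (SqMat 𝔽)} : 0 < (kronList l).1 ↔ ∀ A ∈ l, 0 < A.1 := by
  rw [kronList_order, Nat.pos_iff_ne_zero, ne_eq, List.prod_eq_zero_iff]
  constructor
  · intro h A hA
    exact Nat.pos_of_ne_zero fun h0 => h (List.mem_map.2 ⟨A, hA, h0⟩)
  · intro h h0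
    obtain ⟨A, hA, h0⟩ := List.mem_map.1 h0
    exact (h A hA).ne' h0

theorem pow_length_le_kronList_order (l : List (SqMat 𝔽)) (D : ℝ) (hD : 0 ≤ D)
    (h : ∀ A ∈ l, D ≤ (A.1 : ℝ)) : D ^ l.length ≤ ((kronList l).1 : ℝ) := by
  rw [kronList_order]
  induction l with
  | nil => simp
  | cons A l ih =>
    simp only [List.map_cons, List.prod_cons, Nat.cast_mul, List.length_cons, pow_succ']
    have := ih fun B hB => h B (by simp [hB])
    have := h A (by simp)
    gcongr

theorem kronList_order_le_pow_length (l : List (SqMat 𝔽)) (D : ℝ) (hD : 0 ≤ D)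
    (h : ∀ A ∈ l, (A.1 : ℝ) ≤ D) : ((kronList l).1 : ℝ) ≤ D ^ l.length := by
  rw [kronList_order]
  induction l with
  | nil => simp
  | cons A l ih =>
    simp only [List.map_cons, List.prod_cons, Nat.cast_mul, List.length_cons, pow_succ']
    have := ih fun B hB => h B (by simp [hB])
    have := h A (by simp)
    gcongr

end MatEquiv

/-! ### Products within one size class. -/

section Class

variable {𝔽 : Type*} [Field 𝔽]

/-- Expand the product of (sparse + low rank). Terms with at least `a` low-rank factors have
relative rank at most σ^a, and the rest have at most a - 1 dense factors, hence the E^(a-1); 2^k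
bounds the number of terms. The induction on the list uses thresholds a + 1 and a for the tail,
according to the part taken from the head. -/
theorem NonRigid.kronList_threshold (l : List (SqMat 𝔽)) (σ ε E : ℝ) (hσ : 0 ≤ σ) (hε : 0 ≤ ε)
    (hE : 1 ≤ E) (hl : ∀ A ∈ l, 0 < A.1 ∧ (A.1 : ℝ) ≤ E ∧ NonRigid A.2 σ ((A.1 : ℝ) ^ ε)) (a : ℕ) :
    NonRigid (kronList l).2 (2 ^ l.length * σ ^ a)
      (2 ^ l.length * ((kronList l).1 : ℝ) ^ ε * (E ^ a / E)) := by
  induction l generalizing a with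
  | nil =>
    rcases a with _ | a
    · exact (NonRigid.trivial _ (by positivity)).mono (by simp) le_rfl
    · refine (NonRigid.self _).mono (by positivity) ?_
      rw [Fintype.card_fin]
      have : 1 ≤ E ^ a := one_le_pow₀ hE
      have hE' : E ^ (a + 1) / E = E ^ a := by field_simp; ring
      simp [kronList_nil, hE', this]
  | cons A l ih =>
    rcases a with _ | a
    · refine (NonRigid.trivial _ (by positivity)).mono ?_ le_rfl
      simpa using one_le_pow₀ one_le_two
    · obtain ⟨hA0, hAE, hA⟩ := hl A (by simp)
      have ih' := ih fun B hB => hl B (by simp [hB])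
      refine ((matEquiv_kronList_cons A l).nonRigid
        (hA.kronecker_mix (ih' (a + 1)) (ih' a) hσ (by positivity))).mono (le_of_eq ?_) ?_
      · rw [List.length_cons]; ring
      · have hn : ((kronList (A :: l)).1 : ℝ) = A.1 * (kronList l).1 := by
          rw [kronList_cons, ← Nat.cast_mul]; rfl
        have hd : (1 : ℝ) ≤ (A.1 : ℝ) ^ ε := Real.one_le_rpow (by exact_mod_cast hA0) hε
        have hE' : E ^ (a + 1) / E = E ^ a := by field_simp; ring
        rw [hn, Real.mul_rpow (by positivity) (by positivity), List.length_cons, pow_succ (2 : ℝ),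
          Fintype.card_fin, hE']
        have h1 : (A.1 : ℝ) * (E ^ a / E) ≤ (A.1 : ℝ) ^ ε * E ^ a := by
          calc (A.1 : ℝ) * (E ^ a / E) ≤ E * (E ^ a / E) := by gcongr
            _ = 1 * E ^ a := by field_simp
            _ ≤ _ := by gcongr
        have h2 : 0 ≤ 2 ^ l.length * ((kronList l).1 : ℝ) ^ ε := by positivity
        nlinarith

/-- Kronecker products of matrices of comparable (logarithmic) sizes. -/
theorem NonRigid.kronList_of_comparable (l : List (SqMat 𝔽)) (u ε D : ℝ) (hu : 0 ≤ u) (hε : 0 < ε)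
    (hD : 1 ≤ D) (hDε : 2 ≤ D ^ ε) (huε : 2 * Real.log 2 ≤ u * ε)
    (hl : ∀ A ∈ l, D ≤ (A.1 : ℝ) ∧ (A.1 : ℝ) ≤ D ^ 2 ∧
      NonRigid A.2 (Real.exp (-u)) ((A.1 : ℝ) ^ ε)) :
    NonRigid (kronList l).2 (Real.exp (-(u * ε / 2 * l.length)))
      (((kronList l).1 : ℝ) ^ (4 * ε)) := by
  set k := l.length with hk
  set a := ⌈ε * k⌉₊ with ha
  have hD0 : 0 < D := by linarith
  have hn := pow_length_le_kronList_order l D hD0.le fun A hA => (hl A hA).1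
  rw [← hk] at hn
  set n : ℝ := ((kronList l).1 : ℝ) with hn'
  have hn0 : 0 < n := lt_of_lt_of_le (by positivity) hn
  refine (NonRigid.kronList_threshold l (Real.exp (-u)) ε (D ^ 2) (by positivity) hε.le
    (one_le_pow₀ hD) (fun A hA => ⟨?_, (hl A hA).2⟩) a).mono ?_ ?_
  · have := (hl A hA).1
    exact_mod_cast hD0.trans_le this
  -- Half of the exponent uεk absorbs the 2^k terms, by `huε`.
  · have h1 : ε * k ≤ a := Nat.le_ceil _
    rw [← hk, ← Real.exp_nat_mul, ← Real.exp_log (show (0 : ℝ) < 2 ^ k by positivity),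
      Real.log_pow, ← Real.exp_add]
    gcongr
    have h2 : u * (ε * k) ≤ u * a := by gcongr
    have h3 : 2 * Real.log 2 * k ≤ u * ε * k := by gcongr
    nlinarith
  · have h1 : (2 : ℝ) ^ k ≤ n ^ ε := by
      calc (2 : ℝ) ^ k ≤ (D ^ ε) ^ k := by gcongr
        _ = (D ^ k) ^ ε := by
          rw [← Real.rpow_natCast, ← Real.rpow_mul hD0.le, ← Real.rpow_natCast,
            ← Real.rpow_mul hD0.le, mul_comm]
        _ ≤ n ^ ε := by gcongr
    have h2 : (D ^ 2) ^ a / D ^ 2 ≤ n ^ (2 * ε) := by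
      -- Since a - 1 < εk, the division by D² absorbs the rounding up.
      have h3 : (a : ℝ) < ε * k + 1 := Nat.ceil_lt_add_one (by positivity)
      calc (D ^ 2) ^ a / D ^ 2 = D ^ (2 * (a : ℝ) - 2) := by
            rw [Real.rpow_sub hD0, Real.rpow_mul hD0.le, Real.rpow_natCast]
            norm_cast
        _ ≤ D ^ ((k : ℝ) * (2 * ε)) := by
            apply Real.rpow_le_rpow_of_exponent_le hD
            linarith
        _ = (D ^ k) ^ (2 * ε) := by rw [Real.rpow_mul hD0.le, Real.rpow_natCast]
        _ ≤ n ^ (2 * ε) := by gcongr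
    calc 2 ^ k * n ^ ε * ((D ^ 2) ^ a / D ^ 2) ≤ n ^ ε * n ^ ε * n ^ (2 * ε) := by gcongr
      _ = n ^ (4 * ε) := by
        rw [← Real.rpow_add hn0, ← Real.rpow_add hn0]
        ring_nf

theorem NonRigid.kronList_of_bounded (𝔽 : Type*) [Field 𝔽] (b : ℕ) (ε : ℝ) (hε : 0 < ε) :
    ∃ C γ : ℝ, 0 ≤ C ∧ 0 < γ ∧ ∀ l : List (SqMat 𝔽), (∀ A ∈ l, 2 ≤ A.1 ∧ A.1 ≤ b) →
      NonRigid (kronList l).2 (C * Real.exp (-(γ * l.length)))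
        (((kronList l).1 : ℝ) ^ (4 * ε)) := by
  obtain ⟨C, γ, hC, hγ, h⟩ := NonRigid.exists_of_bounded 𝔽 b ε hε
  refine ⟨C, γ, hC, hγ, fun l hl => ?_⟩
  refine ((matEquiv_kronList_piKronecker l).nonRigid (h l.length _ _ fun i => ?_)).mono le_rfl ?_
  · have := hl (l.get i) (List.get_mem _ _)
    exact ⟨by omega, this.2⟩
  · have h1 := pow_length_le_kronList_order l 2 zero_le_two fun A hA => by
      exact_mod_cast (hl A hA).1
    refine le_trans ?_ (Real.rpow_le_rpow (by positivity) h1 (by positivity))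
    rw [← Real.rpow_natCast, ← Real.rpow_mul zero_le_two, Real.rpow_def_of_pos zero_lt_two]
    apply Real.exp_le_exp.2
    have h2 := Real.log_two_gt_d9
    have h3 : (0 : ℝ) ≤ ε * l.length := by positivity
    nlinarith

theorem NonRigid.of_rcRigidity_le {n : ℕ} (A : Matrix (Fin n) (Fin n) 𝔽) (r : ℕ) (ρ τ : ℝ)
    (hr : (r : ℝ) ≤ ρ * n) (h : (rcRigidity A r : ℝ) ≤ τ) : NonRigid A ρ τ := by
  -- Nonemptiness ensures that the infimum is attained rather than the default 0.
  have hne : {t : ℕ | ∃ Z : Matrix (Fin n) (Fin n) 𝔽, (A - Z).rank ≤ r ∧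
    (∀ i, {j | Z i j ≠ 0}.ncard ≤ t) ∧ (∀ j, {i | Z i j ≠ 0}.ncard ≤ t)}.Nonempty := by
    refine ⟨n, A, by simp, fun i => ?_, fun i => ?_⟩ <;>
    exact (Set.ncard_le_card _).trans (by simp)
  obtain ⟨Z, h1, h2, -⟩ := Nat.sInf_mem hne
  refine ⟨Z, ?_, fun i => le_trans (Nat.cast_le.2 (h2 i)) h⟩
  rw [Fintype.card_fin]
  exact (Nat.cast_le.2 h1).trans hr

theorem NonRigid.rigidity_le {n : ℕ} {A : Matrix (Fin n) (Fin n) 𝔽} {ρ τ : ℝ}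
    (h : NonRigid A ρ τ) : (rigidity A ⌊ρ * n⌋₊ : ℝ) ≤ n * τ := by
  classical
  obtain ⟨Z, h1, h2⟩ := h
  rw [Fintype.card_fin] at h1
  have h3 : rigidity A ⌊ρ * n⌋₊ ≤ {p : Fin n × Fin n | Z p.1 p.2 ≠ 0}.ncard :=
    Nat.sInf_le ⟨Z, Nat.le_floor h1, rfl⟩
  have h4 : {p : Fin n × Fin n | Z p.1 p.2 ≠ 0}.ncard = ∑ i, {j | Z i j ≠ 0}.ncard := by
    have hc : ∀ (X : Type) [Fintype X] (P : X → Prop) [DecidablePred P],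
        {x | P x}.ncard = ∑ x, if P x then 1 else 0 := by
      intro X _ P _
      rw [← Finset.card_filter, ← Set.ncard_coe_finset]
      congr 1; ext; simp
    simp only [hc]
    exact Fintype.sum_prod_type _
  rw [h4] at h3
  calc (rigidity A ⌊ρ * n⌋₊ : ℝ) ≤ ((∑ i, {j | Z i j ≠ 0}.ncard : ℕ) : ℝ) := Nat.cast_le.2 h3
    _ ≤ ∑ _i : Fin n, τ := by push_cast; exact Finset.sum_le_sum fun i _ => h2 i
    _ = n * τ := by simp

end Class

open Filter Topology

/-! ### Growth estimates in L = log n. -/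

section Asymptotics

theorem eventually_logb_le_rpow {β : ℝ} (a : ℝ) {r : ℝ} (hr : 0 < r) :
    ∀ᶠ L : ℝ in atTop, Real.logb β L + a ≤ L ^ r := by
  have h1 : (fun L : ℝ => Real.logb β L + a) =o[atTop] fun L => L ^ r := by
    refine Asymptotics.IsLittleO.add ?_ ?_
    · have : Real.logb β = fun L : ℝ => (Real.log β)⁻¹ * Real.log L := by
        funext L
        rw [Real.logb, div_eq_inv_mul]
      rw [this]
      exact (isLittleO_log_rpow_atTop hr).const_mul_left _
    · exact Asymptotics.isLittleO_const_left.2 (Or.inr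
        (tendsto_norm_atTop_atTop.comp (tendsto_rpow_atTop hr)))
  filter_upwards [h1.bound one_pos, eventually_gt_atTop 0] with L hL hL0
  have h2 : 0 ≤ L ^ r := Real.rpow_nonneg hL0.le r
  rw [one_mul, Real.norm_of_nonneg h2] at hL
  exact (le_abs_self _).trans hL

/-- The estimates needed to absorb logarithmically many error terms. -/
theorem eventually_exp_le {β : ℝ} (hβ : 1 < β) (C g : ℝ) (hC : 0 ≤ C) (hg : 0 < g) :
    ∀ᶠ L : ℝ in atTop, ∃ m : ℕ, m = ⌊Real.logb 2 L⌋₊ + 3 ∧ 0 < Real.logb β L ∧ 1 < L ∧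
      C * Real.exp (-(g * (L / m))) ≤ 1 / (m * Real.logb β L) ∧
      Real.exp (-(g * (√L / m))) ≤ 1 / (m * Real.logb β L) ∧
      Real.exp (-(g * Real.logb 2 L ^ 2)) ≤ 1 / (m * Real.logb β L) := by
  have hdecay : Tendsto (fun y : ℝ => (C + 1) * (y ^ (2 : ℝ) * Real.exp (-g * y))) atTop (𝓝 0) := by
    simpa using (tendsto_rpow_mul_exp_neg_mul_atTop_nhds_zero 2 g hg).const_mul (C + 1)
  have hdecay' := (hdecay.comp (tendsto_rpow_atTop (show (0 : ℝ) < 1 / 4 by norm_num))).eventually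
    (gt_mem_nhds one_pos)
  filter_upwards [eventually_logb_le_rpow (β := 2) 3 (show (0 : ℝ) < 1 / 4 by norm_num),
    eventually_logb_le_rpow (β := β) 0 (show (0 : ℝ) < 1 / 4 by norm_num), hdecay',
    eventually_gt_atTop 1,
    Real.tendsto_log_atTop.eventually (eventually_ge_atTop (Real.log 2 ^ 2 / (2 * g)))]
    with L h2 h3 h4 h5 h6
  have hL0 : 0 < L := by linarith
  have hlog : 0 < Real.log L := Real.log_pos h5
  have hls : 0 < Real.logb β L := Real.logb_pos hβ h5
  have hl2 : 0 < Real.logb 2 L := Real.logb_pos one_lt_two h5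
  set m : ℕ := ⌊Real.logb 2 L⌋₊ + 3 with hm
  have hm0 : (0 : ℝ) < m := by rw [hm]; positivity
  have hmL : (m : ℝ) ≤ L ^ (1 / 4 : ℝ) := by
    rw [hm]; push_cast
    linarith [Nat.floor_le hl2.le]
  -- Both m and log L are at most y, so m log L ≤ y² = √L, while L/m and √L/m are at least y. Hence
  -- exp(-gy) suffices for the first two bounds.
  set y := L ^ (1 / 4 : ℝ) with hy
  have hy0 : 0 < y := Real.rpow_pos_of_pos hL0 _
  have hy1 : 1 ≤ y := Real.one_le_rpow h5.le (by norm_num)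
  have hy4 : y ^ 4 = L := by rw [hy, ← Real.rpow_natCast, ← Real.rpow_mul hL0.le]; norm_num
  have hsq : √L = y ^ 2 := by
    rw [Real.sqrt_eq_iff_mul_self_eq hL0.le (by positivity), ← hy4]; ring
  have hprod : m * Real.logb β L ≤ y ^ 2 := by
    rw [sq]
    gcongr
    linarith
  have hinv : 1 / y ^ 2 ≤ 1 / (m * Real.logb β L) := by
    apply one_div_le_one_div_of_le (by positivity) hprod
  have h4' : (C + 1) * Real.exp (-(g * y)) ≤ 1 / y ^ 2 := by
    rw [le_div_iff₀ (by positivity)]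
    simp only [Function.comp_apply, ← hy, Real.rpow_two, neg_mul] at h4
    linarith
  have hsm : y ≤ √L / m := by
    rw [le_div_iff₀ hm0, hsq, sq]
    gcongr
  have hLm : y ≤ L / m := by
    refine hsm.trans ?_
    gcongr
    rw [hsq, ← hy4]
    exact pow_le_pow_right₀ hy1 (by norm_num)
  have hexp := Real.exp_pos (-(g * y))
  refine ⟨m, rfl, hls, h5, ?_, ?_, ?_⟩
  · calc C * Real.exp (-(g * (L / m))) ≤ C * Real.exp (-(g * y)) := by gcongr
      _ ≤ (C + 1) * Real.exp (-(g * y)) := by gcongr; linarith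
      _ ≤ _ := h4'.trans hinv
  · calc Real.exp (-(g * (√L / m))) ≤ Real.exp (-(g * y)) := by gcongr
      _ ≤ (C + 1) * Real.exp (-(g * y)) := by nlinarith
      _ ≤ _ := h4'.trans hinv
  · refine le_trans ?_ hinv
    -- The target is exp(-(log L)/2), so an exponent quadratic in log L wins.
    have : 1 / y ^ 2 = Real.exp (-(Real.log L / 2)) := by
      rw [Real.exp_neg, ← hsq, one_div, Real.exp_half, Real.exp_log hL0]
    rw [this]
    gcongr
    rw [Real.logb, div_pow]
    rw [div_le_iff₀ (by positivity)] at h6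
    have hl : 0 < Real.log 2 ^ 2 := by have := Real.log_pos one_lt_two; positivity
    rw [← mul_div_assoc, div_le_div_iff₀ two_pos hl]
    nlinarith

end Asymptotics

/-! ### Dyadic classes and assembly of the whole product. -/

section Main

variable {𝔽 : Type*} [Field 𝔽]

theorem NonRigid.of_gammaExp {β ε : ℝ} (hβ : 1 < β) (hε : 0 < ε) (A : SqMat 𝔽) (j : ℕ)
    (hj : (2 : ℝ) ^ j ≤ Real.logb β A.1)
    (h : (rcRigidity A.2 ⌊(A.1 : ℝ) ^ (1 - gammaExp β ε A.1)⌋₊ : ℝ) ≤ (A.1 : ℝ) ^ ε) :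
    NonRigid A.2 (Real.exp (-(12 * Real.logb β 2 ^ 2 * Real.log β / ε ^ 3 * j ^ 2)))
      ((A.1 : ℝ) ^ ε) := by
  have hlogβ : 0 < Real.log β := Real.log_pos hβ
  have hlogd : 0 < Real.logb β A.1 := lt_of_lt_of_le (by positivity) hj
  have hd : (0 : ℝ) < A.1 := by
    rcases Nat.eq_zero_or_pos A.1 with h0 | h0
    · simp [h0] at hlogd
    · exact_mod_cast h0
  have hll : j * Real.logb β 2 ≤ Real.logb β (Real.logb β A.1) := by
    rw [← Real.logb_pow]
    exact Real.logb_le_logb_of_le hβ (by positivity) hj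
  have h2 : 0 ≤ Real.logb β 2 := Real.logb_nonneg hβ one_le_two
  refine NonRigid.of_rcRigidity_le _ _ _ _ ?_ h
  refine (Nat.floor_le (by positivity)).trans ?_
  rw [Real.rpow_sub hd, Real.rpow_one, div_eq_inv_mul, ← Real.rpow_neg hd.le,
    Real.rpow_def_of_pos hd]
  gcongr
  -- The factor log d cancels, leaving (log log d)², which is at least of order j².
  have hγ : Real.log A.1 * -gammaExp β ε A.1 =
      -(12 * Real.logb β (Real.logb β A.1) ^ 2 * Real.log β / ε ^ 3) := by
    have : Real.log A.1 = Real.logb β A.1 * Real.log β := by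
      rw [Real.logb, div_mul_cancel₀ _ hlogβ.ne']
    rw [gammaExp, this]
    field_simp
  rw [hγ]
  have h3 : (j * Real.logb β 2) ^ 2 ≤ Real.logb β (Real.logb β A.1) ^ 2 := by
    gcongr
  calc _ ≤ -(12 * (j * Real.logb β 2) ^ 2 * Real.log β / ε ^ 3) := by gcongr
    _ = _ := by ring

/-- From `j₀` on, the hypotheses of `NonRigid.kronList_of_comparable` that absorb 2^k hold; smaller
orders are treated as bounded. -/
theorem exists_dyadic_start {β ε c : ℝ} (hβ : 1 < β) (hε : 0 < ε) (hc : 0 < c) :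
    ∃ j₀ : ℕ, 1 ≤ j₀ ∧ ∀ j ≥ j₀, 2 ≤ (β ^ (2 ^ j : ℝ)) ^ ε ∧
      2 * Real.log 2 ≤ c * j ^ 2 * ε := by
  have h1 : Tendsto (fun j : ℕ => c * (j : ℝ) ^ 2 * ε) atTop atTop :=
    (((tendsto_pow_atTop two_ne_zero).comp tendsto_natCast_atTop_atTop).const_mul_atTop
      hc).atTop_mul_const hε
  have h2 : Tendsto (fun j : ℕ => Real.log β * (2 : ℝ) ^ j * ε) atTop atTop :=
    ((tendsto_pow_atTop_atTop_of_one_lt one_lt_two).const_mul_atTop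
      (Real.log_pos hβ)).atTop_mul_const hε
  obtain ⟨j₀, h⟩ := eventually_atTop.1 ((h1.eventually (eventually_ge_atTop (2 * Real.log 2))).and
    ((h2.eventually (eventually_ge_atTop (Real.log 2))).and (eventually_ge_atTop 1)))
  refine ⟨j₀, (h j₀ le_rfl).2.2, fun j hj => ⟨?_, (h j hj).1⟩⟩
  have hβ0 : 0 < β := by linarith
  rw [← Real.rpow_mul hβ0.le, Real.rpow_def_of_pos hβ0, ← Real.log_le_iff_le_exp two_pos]
  have := (h j hj).2.1
  linarith

/-- Kronecker products of matrices of one dyadic size class, when their total size is large. -/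
theorem NonRigid.kronList_dyadic {β ε : ℝ} (hβ : 1 < β) (hε : 0 < ε) {c : ℝ} (hc : 0 < c) {j : ℕ}
    (hj : 1 ≤ j) (hD : 2 ≤ (β ^ (2 ^ j : ℝ)) ^ ε) (hcj : 2 * Real.log 2 ≤ c * j ^ 2 * ε)
    (l : List (SqMat 𝔽))
    (hl : ∀ A ∈ l, (2 : ℝ) ^ j ≤ Real.logb β A.1 ∧ Real.logb β A.1 ≤ 2 ^ (j + 1) ∧
      NonRigid A.2 (Real.exp (-(c * j ^ 2))) ((A.1 : ℝ) ^ ε))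
    {L δ : ℝ} (hL : 1 < L) (hδ : 0 < δ) (hbig : δ * L < Real.logb β (kronList l).1) :
    NonRigid (kronList l).2 (max (Real.exp (-(c * ε * (δ * √L) / 4)))
      (Real.exp (-(c * ε / 8 * Real.logb 2 L ^ 2)))) (((kronList l).1 : ℝ) ^ (4 * ε)) := by
  have hβ0 : 0 < β := by linarith
  have hlogβ : 0 < Real.log β := Real.log_pos hβ
  set D : ℝ := β ^ (2 ^ j : ℝ) with hDdef
  have hD1 : 1 ≤ D := Real.one_le_rpow hβ.le (by positivity)
  have hD2 : D ^ 2 = β ^ (2 ^ (j + 1) : ℝ) := by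
    rw [hDdef, ← Real.rpow_natCast, ← Real.rpow_mul hβ0.le, pow_succ]
    norm_num
  have hpos : ∀ A ∈ l, (0 : ℝ) < A.1 := by
    intro A hA
    rcases Nat.eq_zero_or_pos A.1 with h0 | h0
    -- As the logarithm of 0 is 0 by convention, the lower bound excludes order 0.
    · have := (hl A hA).1
      rw [h0] at this
      simp only [Nat.cast_zero, Real.logb_zero] at this
      have h3 : (0 : ℝ) < 2 ^ j := by positivity
      linarith
    · exact_mod_cast h0
  have hsize : ∀ A ∈ l, (A.1 : ℝ) ≤ D ^ 2 := by
    intro A hA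
    rw [hD2]
    exact (Real.logb_le_iff_le_rpow hβ (hpos A hA)).1 (hl A hA).2.1
  refine (NonRigid.kronList_of_comparable l (c * j ^ 2) ε D (by positivity) hε hD1 hD hcj
    fun A hA => ⟨(Real.le_logb_iff_rpow_le hβ (hpos A hA)).1 (hl A hA).1, hsize A hA,
      (hl A hA).2.2⟩).mono ?_ le_rfl
  set k := l.length
  have hn : Real.logb β (kronList l).1 ≤ k * 2 ^ (j + 1) := by
    have h1 := kronList_order_le_pow_length l (D ^ 2) (by positivity) hsize
    have h0 : (0 : ℝ) < (kronList l).1 := by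
      exact_mod_cast kronList_order_pos.2 fun A hA => by exact_mod_cast hpos A hA
    have h2 := Real.logb_le_logb_of_le hβ h0 h1
    rwa [Real.logb_pow, hD2, Real.logb_rpow hβ0 hβ.ne'] at h2
  have hk2 : δ * L < k * 2 ^ (j + 1) := hbig.trans_le hn
  have hk1 : (1 : ℝ) ≤ k := by
    have : 0 < k := by
      rcases Nat.eq_zero_or_pos k with h0 | h0
      · rw [h0] at hk2
        have : 0 < δ * L := by positivity
        simp at hk2
        linarith
      · exact h0
    exact_mod_cast this
  have hj1 : (1 : ℝ) ≤ (j : ℝ) := by exact_mod_cast hj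
  have hsqrt : 0 < √L := Real.sqrt_pos.2 (by linarith)
  have hss : √L * √L = L := Real.mul_self_sqrt (by linarith)
  -- If 2^j ≤ √L, the class needs at least δ√L/2 factors to be large. Otherwise j ≥ (log₂ L)/2, and
  -- a single factor already saves enough.
  rcases le_or_gt ((2 : ℝ) ^ j) √L with hcase | hcase
  · refine le_trans ?_ (le_max_left _ _)
    have h1 : δ * √L / 2 ≤ k := by
      have h2 : δ * √L * √L < 2 * k * √L := by
        calc δ * √L * √L = δ * L := by rw [mul_assoc, hss]
          _ < k * 2 ^ (j + 1) := hk2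
          _ = 2 * k * 2 ^ j := by ring
          _ ≤ 2 * k * √L := by gcongr
      have := lt_of_mul_lt_mul_right h2 hsqrt.le
      linarith
    apply Real.exp_le_exp.2
    have h3 : c * 1 ^ 2 * ε / 2 * (δ * √L / 2) ≤ c * j ^ 2 * ε / 2 * k := by gcongr
    linarith
  · refine le_trans ?_ (le_max_right _ _)
    have h1 : Real.logb 2 L / 2 ≤ j := by
      have h2 : L < 2 ^ (2 * j) := by
        rw [mul_comm, pow_mul, sq, ← hss]
        gcongr
      have h3 := Real.logb_le_logb_of_le one_lt_two (by linarith) h2.le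
      rw [Real.logb_pow, Real.logb_self_eq_one one_lt_two] at h3
      push_cast at h3
      linarith
    have h0 : 0 < Real.logb 2 L := Real.logb_pos one_lt_two hL
    apply Real.exp_le_exp.2
    have h3 : c * (Real.logb 2 L / 2) ^ 2 * ε / 2 * 1 ≤ c * j ^ 2 * ε / 2 * k := by gcongr
    linarith

theorem NonRigid.eventually_kronList {β ε : ℝ} (hβ : 1 < β) (hε : 0 < ε) {b : ℕ} (hb : 2 ≤ b)
    {F : Set (SqMat 𝔽)} (hF : BoundedOrNonRigid β ε b F) :
    ∀ᶠ L : ℝ in atTop, ∀ l : List (SqMat 𝔽), (∀ A ∈ l, A ∈ F) → 0 < (kronList l).1 →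
      Real.logb β (kronList l).1 = L →
      NonRigid (kronList l).2 (1 / Real.logb β L) (((kronList l).1 : ℝ) ^ (5 * ε)) := by
  have hβ0 : 0 < β := by linarith
  have hlogβ : 0 < Real.log β := Real.log_pos hβ
  set c := 12 * Real.logb β 2 ^ 2 * Real.log β / ε ^ 3 with hc
  have hc0 : 0 < c := by
    have := Real.logb_pos hβ one_lt_two
    positivity
  obtain ⟨j₀, hj₀, hstart⟩ := exists_dyadic_start hβ hε hc0
  set B := max b ⌈β ^ (2 ^ j₀ : ℝ)⌉₊ with hB
  have hB2 : 2 ≤ B := hb.trans (le_max_left _ _)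
  have hlogB : 0 < Real.log B := Real.log_pos (by exact_mod_cast hB2)
  obtain ⟨C, γ, hC, hγ, hbdd⟩ := NonRigid.kronList_of_bounded 𝔽 B ε hε
  -- One rate below the three that arise: from bounded factors, from many factors, and from large j.
  set g := min (γ * (ε * Real.log β) / Real.log B) (min (c * ε * ε / 4) (c * ε / 8)) with hg
  have hg0 : 0 < g := by positivity
  filter_upwards [eventually_exp_le hβ C g hC hg0] with L hL l hlF hn hnL
  obtain ⟨m, hm, hLs, hL1, e1, e2, e3⟩ := hL
  have hm0 : (0 : ℝ) < m := by rw [hm]; positivity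
  have hlpos := kronList_order_pos.1 hn
  set n : ℝ := ((kronList l).1 : ℝ) with hndef
  have hn0 : 0 < n := Nat.cast_pos.2 hn
  have hn1 : 1 ≤ n := Nat.one_le_cast.2 hn
  -- The shift by 2 makes room for orders at most 1 and for bounded orders, whence the 3 in `m`.
  let κ : SqMat 𝔽 → ℕ := fun A => if A.1 ≤ 1 then 0 else if A.1 ≤ B then 1 else
    ⌊Real.logb 2 (Real.logb β A.1)⌋₊ + 2
  have hbigd : ∀ A : SqMat 𝔽, B < A.1 → (2 : ℝ) ^ j₀ ≤ Real.logb β A.1 := by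
    intro A hA
    have h1 : β ^ (2 ^ j₀ : ℝ) ≤ A.1 :=
      (Nat.le_ceil _).trans (by exact_mod_cast (le_max_right _ _).trans hA.le)
    exact (Real.le_logb_iff_rpow_le hβ ((Real.rpow_pos_of_pos hβ0 _).trans_le h1)).2 h1
  have hκ : ∀ A ∈ l, κ A < m := by
    intro A hA
    simp only [κ]
    split_ifs with h1 h2
    · omega
    · omega
    · have h3 : (A.1 : ℝ) ≤ n := by
        rw [hndef, kronList_order]
        exact_mod_cast Nat.le_of_dvd (by rw [← kronList_order]; exact hn)
          (List.dvd_prod (List.mem_map.2 ⟨A, hA, rfl⟩))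
      have h4 := hbigd A (by omega)
      have h5 : Real.logb β A.1 ≤ L := by
        rw [← hnL]
        exact Real.logb_le_logb_of_le hβ (by exact_mod_cast hlpos A hA) h3
      have h6 := Real.logb_le_logb_of_le one_lt_two (lt_of_lt_of_le (by positivity) h4) h5
      have := Nat.floor_le_floor h6
      omega
  have hfilter : l.filter (fun A => κ A < m) = l := by
    rw [List.filter_eq_self]
    intro A hA
    simpa using hκ A hA
  let N : ℕ → ℝ := fun i => ((kronList (l.filter fun A => κ A = i)).1 : ℝ)
  have hN1 : ∀ i, 1 ≤ N i := by
    intro i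
    have : 0 < (kronList (l.filter fun A => κ A = i)).1 :=
      kronList_order_pos.2 fun A hA => hlpos A (List.mem_of_mem_filter hA)
    exact Nat.one_le_cast.2 this
  have hN0 : ∀ i, 0 < N i := fun i => one_pos.trans_le (hN1 i)
  have hclass : ∀ i < m, NonRigid (kronList (l.filter fun A => κ A = i)).2
      (1 / (m * Real.logb β L)) (N i ^ (4 * ε) * n ^ (ε / m)) := by
    intro i hi
    have hnm : 1 ≤ n ^ (ε / m) := Real.one_le_rpow hn1 (by positivity)
    have hNi : 1 ≤ N i ^ (4 * ε) := Real.one_le_rpow (hN1 i) (by positivity)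
    have hρ : 0 ≤ 1 / (m * Real.logb β L) := by positivity
    -- A small class is its own sparse part, with rank error 0. The slack n^(ε/m), granted to all m
    -- classes, multiplies to n^ε.
    rcases le_or_gt (N i) (n ^ (ε / m)) with hsmall | hlarge
    · refine (NonRigid.self _).mono hρ ?_
      rw [Fintype.card_fin]
      change N i ≤ _
      nlinarith
    have hlarge' : ε / m * L < Real.logb β (N i) := by
      rw [← hnL, ← Real.logb_rpow_eq_mul_logb_of_pos hn0]
      exact Real.logb_lt_logb hβ (by positivity) hlarge
    have hle : N i ^ (4 * ε) ≤ N i ^ (4 * ε) * n ^ (ε / m) := by nlinarith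
    obtain _ | _ | j := i
    · exfalso
      have : N 0 ≤ 1 := by
        have := kronList_order_le_pow_length (l.filter fun A => κ A = 0) 1 zero_le_one ?_
        · exact this.trans_eq (one_pow _)
        · intro A hA
          have h1 := (List.mem_filter.1 hA).2
          simp only [κ, decide_eq_true_eq] at h1
          split_ifs at h1 with h2 h3
          exact_mod_cast h2
      linarith
    · have hmem : ∀ A ∈ l.filter (fun A => κ A = 0 + 1), 2 ≤ A.1 ∧ A.1 ≤ B := by
        intro A hA
        have h1 := (List.mem_filter.1 hA).2
        simp only [κ, decide_eq_true_eq] at h1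
        split_ifs at h1 with h2 h3
        · omega
        · omega
      refine (hbdd _ hmem).mono (le_trans ?_ e1) hle
      refine mul_le_mul_of_nonneg_left (Real.exp_le_exp.2 (neg_le_neg ?_)) hC
      set k := (l.filter fun A => κ A = 0 + 1).length
      have h1 : N (0 + 1) ≤ (B : ℝ) ^ k := kronList_order_le_pow_length _ B (by positivity)
        fun A hA => by exact_mod_cast (hmem A hA).2
      have h2 : ε / m * L * Real.log β ≤ k * Real.log B := by
        have h3 := Real.log_le_log (hN0 _) h1
        rw [Real.log_pow] at h3
        rw [Real.logb, lt_div_iff₀ hlogβ] at hlarge'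
        linarith
      calc g * (L / m) ≤ γ * (ε * Real.log β) / Real.log B * (L / m) := by
            gcongr
            exact min_le_left _ _
        _ = γ * (ε / m * L * Real.log β) / Real.log B := by ring
        _ ≤ γ * (k * Real.log B) / Real.log B := by gcongr
        _ = γ * k := by field_simp
    · have hmem : ∀ A ∈ l.filter (fun A => κ A = j + 1 + 1),
          B < A.1 ∧ A ∈ F ∧ ⌊Real.logb 2 (Real.logb β A.1)⌋₊ = j := by
        intro A hA
        have h1 := (List.mem_filter.1 hA).2
        simp only [κ, decide_eq_true_eq] at h1
        split_ifs at h1 with h2 h3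
        · omega
        exact ⟨by omega, hlF A (List.mem_of_mem_filter hA), by omega⟩
      have hne : ∃ A, A ∈ l.filter (fun A => κ A = j + 1 + 1) := by
        apply List.exists_mem_of_ne_nil
        intro h0
        have : N (j + 1 + 1) = 1 := by simp only [N, h0, kronList_nil, Nat.cast_one]
        linarith
      have hj : j₀ ≤ j := by
        obtain ⟨A, hA⟩ := hne
        have h1 := hmem A hA
        rw [← h1.2.2]
        have h2 := hbigd A h1.1
        apply Nat.le_floor
        have h3 := Real.logb_le_logb_of_le one_lt_two (by positivity) h2
        rwa [Real.logb_pow, Real.logb_self_eq_one one_lt_two, mul_one] at h3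
      obtain ⟨hs1, hs2⟩ := hstart j hj
      have hδ : 0 < ε / m := by positivity
      refine (NonRigid.kronList_dyadic hβ hε hc0 (hj₀.trans hj) hs1 hs2 _ (fun A hA => ?_) hL1 hδ
        hlarge').mono (max_le (le_trans ?_ e2) (le_trans ?_ e3)) hle
      · obtain ⟨h1, h2, h3⟩ := hmem A hA
        have h4 := hbigd A h1
        have h5 : 0 < Real.logb β A.1 := lt_of_lt_of_le (by positivity) h4
        have h6 : 0 ≤ Real.logb 2 (Real.logb β A.1) :=
          Real.logb_nonneg one_lt_two ((one_le_pow₀ one_le_two).trans h4)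
        have h7 := Nat.floor_le h6
        have h8 := Nat.lt_floor_add_one (Real.logb 2 (Real.logb β A.1))
        rw [h3] at h7 h8
        have h9 : (2 : ℝ) ^ j ≤ Real.logb β A.1 := by
          rw [Real.le_logb_iff_rpow_le one_lt_two h5] at h7
          exact_mod_cast h7
        refine ⟨h9, ?_, ?_⟩
        · rw [Real.logb_lt_iff_lt_rpow one_lt_two h5] at h8
          exact_mod_cast h8.le
        · refine NonRigid.of_gammaExp hβ hε A j h9 ((hF A h2).resolve_left ?_)
          have : b ≤ B := le_max_left _ _
          omega
      · apply Real.exp_le_exp.2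
        have h1 : g ≤ c * ε * ε / 4 := (min_le_right _ _).trans (min_le_left _ _)
        have h2 : g * (√L / m) ≤ c * ε * ε / 4 * (√L / m) := by gcongr
        have h3 : c * ε * ε / 4 * (√L / m) = c * ε * (ε / m * √L) / 4 := by ring
        linarith
      · apply Real.exp_le_exp.2
        have h1 : g ≤ c * ε / 8 := (min_le_right _ _).trans (min_le_right _ _)
        have h2 : g * Real.logb 2 L ^ 2 ≤ c * ε / 8 * Real.logb 2 L ^ 2 := by gcongr
        linarith
  have hmain := NonRigid.kronList_filter_lt l κ (fun _ => 1 / (m * Real.logb β L))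
    (fun i => N i ^ (4 * ε) * n ^ (ε / m)) (fun i => by positivity)
    (fun i => by have := hN0 i; positivity) m hclass
  rw [hfilter] at hmain
  refine hmain.mono (le_of_eq ?_) (le_of_eq ?_)
  · rw [Finset.sum_const, Finset.card_range, nsmul_eq_mul]
    field_simp
  · have hprod : ∏ i ∈ Finset.range m, N i = n := by
      rw [hndef, ← kronList_filter_lt_order l κ m hκ, Nat.cast_prod]
    rw [Finset.prod_mul_distrib, Real.finsetProd_rpow _ _ fun i _ => (hN0 i).le, hprod,
      Finset.prod_const, Finset.card_range, ← Real.rpow_natCast, ← Real.rpow_mul hn0.le,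
      ← Real.rpow_add hn0]
    congr 1
    field_simp
    ring

end Main

/-! ### Contradiction with Valiant-rigidity. -/

theorem mainTheorem5 {𝔽 : Type*} [Field 𝔽] (β : ℝ) (hβ : 1 < β) (F : Set (SqMat 𝔽))
    (hF : ∀ ε : ℝ, 0 < ε → ε < 1 / 2 → ∃ b : ℕ, 2 ≤ b ∧ BoundedOrNonRigid β ε b F) :
    NotValiantRigid β (kroneckerProducts F) := by
  rintro A hA hmono ⟨ε₀, hε₀, N, hN⟩
  -- This gives ε < 1/2 and 5ε ≤ ε₀/2 < ε₀.
  set ε := min ε₀ 1 / 10 with hε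
  have hε0 : 0 < ε := by positivity
  have hε1 : ε ≤ 1 / 10 := by rw [hε]; linarith [min_le_right ε₀ 1]
  have hε2 : ε ≤ ε₀ / 10 := by rw [hε]; linarith [min_le_left ε₀ 1]
  obtain ⟨b, hb, hFb⟩ := hF ε hε0 (by linarith)
  have hlim : Tendsto (fun i => Real.logb β (A i).1) atTop atTop :=
    (Real.tendsto_logb_atTop hβ).comp (tendsto_natCast_atTop_atTop.comp hmono.tendsto_atTop)
  obtain ⟨i, hi, hiN⟩ := ((hlim.eventually (NonRigid.eventually_kronList hβ hε0 hb hFb)).and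
    (hmono.tendsto_atTop.eventually (eventually_ge_atTop (max N 2)))).exists
  have hi2 : 2 ≤ (A i).1 := (le_max_right _ _).trans hiN
  obtain ⟨l, hlF, hln, hl⟩ := exists_kronList_of_isKroneckerProduct (hA i)
  have h1 := hl.nonRigid (hi l hlF (by omega) (by rw [hln]))
  have h2 := h1.rigidity_le
  rw [hln, one_div_mul_eq_div] at h2
  have h3 := (hN i ((le_max_left _ _).trans hiN)).trans h2
  have hn : (1 : ℝ) < (A i).1 := by exact_mod_cast hi2
  rw [Real.rpow_add (by linarith), Real.rpow_one] at h3
  have h4 := le_of_mul_le_mul_left h3 (by linarith)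
  rw [Real.rpow_le_rpow_left_iff hn] at h4
  linarith
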